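/- Let $k$ be an algebraically closed field of characteristic different from $2$. Let $J$ be a $9$-dimensional, nondegenerate, simple quadratic Jordan algebra of a cubic form over $k$. That is, $J$ is a $9$-dimensional vector space with a cubic form $N$, a base point $\mathbf 1\in J$ and a quadratic map $x\mapsto x^\sharp$ on $J$. Put $T(x):=\partial_xN(\mathbf 1)$, $T(x,y):=\partial_xN(\mathbf 1)\,\partial_yN(\mathbf 1)-\partial_x\partial_yN(\mathbf 1)$ and $x\sharp y:=(x+y)^\sharp-x^\sharp-y^\sharp$. The data satisfy, for all $x,y\in J$, $$N(\mathbf 1)=1,\quad (x^\sharp)^\sharp=N(x)x,\quad \partial_yN(x)=T(x^\sharp,y),\quad \mathbf 1\sharp y=T(y)\mathbf 1-y .$$ Put $S(x):=T(x^\sharp)$, $U_xy:=T(x,y)x-x^\sharp\sharp y$, $U_{x,y}:=U_{x+y}-U_x-U_y$, and let $x\bullet y:=\tfrac12U_{x,y}\mathbf 1$ be the Jordan product. Nondegenerate means that $U_x=0$ implies $x=0$. Simple means that the only subspaces $I\subset J$ such that $U_xy\in I$ and $U_yx\in I$ for all $x\in J$, $y\in I$ are $0$ and $J$. Let $\upsilon\in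 J$ be a primitive idempotent ($\upsilon\neq0$, $\upsilon\bullet\upsilon=\upsilon$, $\upsilon^\sharp=0$). Put $\pi_3:=\mathbf 1-\upsilon$, let $J_{1/2}:=U_{\upsilon,\pi_3}(J)$ and $J_0:=U_{\pi_3}(J)$ be the Peirce subspaces, and put $W:=J_0\cap\pi_3^\perp=\{\pi\in J_0 : T(\pi,\pi_3)=0\}$. (1) The space $W$ is $3$-dimensional, and for every $\pi\in W$ the map $\rho\mapsto\pi\sharp\rho$ restricts to an endomorphism $f_\pi$ of $J_{1/2}$. The subalgebra $\mathrm{Cl}$ of $\mathrm{End}_k(J_{1/2})$ generated by the identity and the maps $f_\pi$ $(\pi\in W)$ is the Clifford algebra of $(W,-S|_W)$: there is an isomorphism of $k$-algebras from the Clifford algebra of the quadratic form $-S|_W$ onto $\mathrm{Cl}$ that sends the canonical generator attached to $\pi$ to $f_\pi$, for every $\pi\in W$. (2) For every basis $\pi_1,\pi_2,\pi_4$ of $W$ there is a $2$-dimensional subspace $V\subset J_{1/2}$ such that $\pi_2\sharp V\subset V$, $\pi_4\sharp V\subset V$, $\dim(\pi_1\sharp V)=2$ and $J_{1/2}=V\oplus(\pi_1\sharp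 V)$. -/

import Mathlib

/-- A cubic form `N` on a vector space `J`: `deriv x y` is the value at `x` of the directional
derivative of `N` in the direction `y`; it is quadratic in `x` and linear in `y`, and
`N (x + t y) = N x + t (deriv x y) + t² (deriv y x) + t³ (N y)` for all scalars `t`.
Over a field with more than two elements, `deriv` is determined by `N`. -/
structure CubicForm (k J : Type*) [Field k] [AddCommGroup J] [Module k J] where
  toFun : J → k
  deriv : QuadraticMap k J (Module.Dual k J)
  map_smul : ∀ (a : k) (x : J), toFun (a • x) = a ^ 3 * toFun x
  map_add : ∀ x y : J, toFun (x + y) = toFun x + deriv x y + deriv y x + toFun y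

namespace CubicForm

variable {k J : Type*} [Field k] [AddCommGroup J] [Module k J]

/-- The linear trace with respect to a base point `e`: `T(x) = ∂ₓN(e)`. -/
def trace (N : CubicForm k J) (e : J) : Module.Dual k J := N.deriv e

/-- The bilinear trace with respect to a base point `e`:
`T(x, y) = ∂ₓN(e) ∂ᵧN(e) - ∂ₓ∂ᵧN(e)`. -/
def bilinTrace (N : CubicForm k J) (e : J) : LinearMap.BilinForm k J :=
  (LinearMap.mul k k).compl₁₂ (N.trace e) (N.trace e) - N.deriv.polarBilin e

end CubicForm

/-- A quadratic Jordan algebra of a cubic form: a vector space `J` with a cubic form `N`, a base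
point `𝟙` and a quadratic map `♯` satisfying `N(𝟙) = 1`, `(x♯)♯ = N(x) x`,
`∂ᵧN(x) = T(x♯, y)` and `𝟙 ♯ y = T(y) 𝟙 - y`, where `T` is the (linear, bilinear) trace of `N`
at `𝟙`. (Over an infinite field these identities persist under all scalar extensions.) -/
structure CubicJordanAlgebra (k J : Type*) [Field k] [AddCommGroup J] [Module k J] where
  norm : CubicForm k J
  one : J
  sharp : QuadraticMap k J J
  norm_one : norm.toFun one = 1
  sharp_sharp : ∀ x : J, sharp (sharp x) = norm.toFun x • x
  deriv_norm : ∀ x y : J, norm.deriv x y = norm.bilinTrace one (sharp x) y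
  one_sharp : ∀ y : J, sharp.polarBilin one y = norm.trace one y • one - y

namespace CubicJordanAlgebra

variable {k J : Type*} [Field k] [AddCommGroup J] [Module k J] (A : CubicJordanAlgebra k J)

/-- The linear trace `T(x)`. -/
def tr : Module.Dual k J := A.norm.trace A.one

/-- The bilinear trace `T(x, y)`. -/
def T : LinearMap.BilinForm k J := A.norm.bilinTrace A.one

/-- The `♯`-product `x ♯ y = (x + y)♯ - x♯ - y♯`. -/
def sharpMul : J →ₗ[k] J →ₗ[k] J := A.sharp.polarBilin

/-- The quadratic form `S(x) = T(x♯)`. -/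
def S : QuadraticForm k J := A.tr.compQuadraticMap A.sharp

/-- The U-operator `U_x y = T(x, y) x - x♯ ♯ y`. -/
def U (x : J) : J →ₗ[k] J := (A.T x).smulRight x - A.sharpMul (A.sharp x)

/-- The linearized U-operator `U_{x,y} = U_{x+y} - U_x - U_y`. -/
def U₂ (x y : J) : J →ₗ[k] J := A.U (x + y) - A.U x - A.U y

/-- The Jordan product `x • y = ½ U_{x,y} 𝟙` (characteristic different from two). -/
def jordanMul (x y : J) : J := (2 : k)⁻¹ • A.U₂ x y A.one

/-- A primitive idempotent: a nonzero `e` with `e • e = e` and `e♯ = 0`. -/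
def IsPrimitiveIdempotent (e : J) : Prop := e ≠ 0 ∧ A.jordanMul e e = e ∧ A.sharp e = 0

/-- Nondegeneracy: there are no nonzero absolute zero divisors. -/
def IsNondegenerate : Prop := ∀ x : J, A.U x = 0 → x = 0

/-- Ideals of the quadratic Jordan algebra. -/
def IsIdeal (I : Submodule k J) : Prop := ∀ x : J, ∀ y ∈ I, A.U x y ∈ I ∧ A.U y x ∈ I

/-- Simplicity: `J ≠ 0`, and the only ideals are `0` and `J`. -/
def IsSimple : Prop := Nontrivial J ∧ ∀ I : Submodule k J, A.IsIdeal I → I = ⊥ ∨ I = ⊤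

/-- The Peirce subspace `J_{1/2} = U_{υ, 𝟙 - υ}(J)`. -/
def peirceHalf (υ : J) : Submodule k J := LinearMap.range (A.U₂ υ (A.one - υ))

/-- The Peirce subspace `J₀ = U_{𝟙 - υ}(J)`. -/
def peirceZero (υ : J) : Submodule k J := LinearMap.range (A.U (A.one - υ))

/-- `π^⊥ = {x : T(x, π) = 0}`. -/
def perp (π : J) : Submodule k J := LinearMap.ker (A.T.flip π)

/-- The subspace `J₀ ∩ π₃^⊥`, where `π₃ = 𝟙 - υ`. -/
def peirceZeroPerp (υ : J) : Submodule k J := A.peirceZero υ ⊓ A.perp (A.one - υ)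

/-- The quadratic form `-S` restricted to `J₀ ∩ π₃^⊥`. -/
def negS (υ : J) : QuadraticForm k (A.peirceZeroPerp υ) :=
  (-A.S).comp (A.peirceZeroPerp υ).subtype

end CubicJordanAlgebra

/-! ### Symmetry of the trilinear form and linearizations of the adjoint identity -/

namespace CubicForm

variable {k J : Type*} [Field k] [AddCommGroup J] [Module k J] (N : CubicForm k J)

/-! Write `e` for υ, L for ρ ↦ e ♯ ρ, M for J_{1/2}. Since e♯ = 0, the linearized identity (x♯)♯ =
N(x)x collapses to a quadratic relation for L (`sharpMul_sharpMul`), and J = ke ⊕ k(1-e) ⊕ W ⊕ M,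
where W is the (-1)-eigenspace of L and M the trace-zero part of its kernel. For w in W the same
identity gives w♯ = S(w)e and w ♯ (w ♯ x) = -S(w)x on M: M is a Clifford module for -S|_W.

Dimensions: dim W + dim M = 7. Nondegeneracy of J makes T nondegenerate on W and on M; simplicity
gives M ≠ 0, whence W ≠ 0, and excludes dim W = 1 (`finrank_peirceZeroPerp_ne_one`, the delicate
case). So dim W ≥ 2, dim M is even (determinants of anticommuting operators), and W embeds in End M.
Only (3, 4) remains.

Faithfulness: each f_π is self-adjoint for T|_M, so the volume element z of an orthonormal basis is
skew with z² = -1. Hence z is not a scalar, and the eight Clifford monomials act independently.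

Splitting: M is the sum of two planes on which w acts by matrices P(w) and -P(w) in bases s_i and
t_i. For nonzero u in W orthogonal to π₂ and π₄, let V be spanned by the s_i + f_u t_i. The Clifford
relation makes V stable under every w orthogonal to u, while f_{π₁} moves V by the nonzero scalar
polar(π₁, u) times t_i. -/

theorem polarBilin_deriv_right_comm (x y z : J) :
    N.deriv.polarBilin x y z = N.deriv.polarBilin x z y := by
  have h1 := N.map_add (x + y) z
  have h2 := N.map_add (x + z) y
  rw [show x + z + y = x + y + z by abel, h1, N.map_add x y, N.map_add x z] at h2
  simp only [QuadraticMap.polarBilin_apply_apply, QuadraticMap.polar, LinearMap.sub_apply,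
    _root_.map_add] at h2 ⊢
  linear_combination h2

theorem deriv_self (h2 : (2 : k) ≠ 0) (x : J) : N.deriv x x = 3 * N.toFun x := by
  have h := N.map_add x x
  rw [← two_smul k x, N.map_smul] at h
  refine mul_left_cancel₀ h2 ?_
  linear_combination -h

theorem bilinTrace_comm (e x y : J) : N.bilinTrace e x y = N.bilinTrace e y x := by
  simp only [bilinTrace, LinearMap.sub_apply, LinearMap.compl₁₂_apply, LinearMap.mul_apply']
  rw [N.polarBilin_deriv_right_comm e x y, mul_comm]

end CubicForm

namespace CubicJordanAlgebra

variable {k J : Type*} [Field k] [AddCommGroup J] [Module k J] (A : CubicJordanAlgebra k J)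

theorem T_comm (x y : J) : A.T x y = A.T y x := A.norm.bilinTrace_comm A.one x y

theorem sharpMul_comm (x y : J) : A.sharpMul x y = A.sharpMul y x := by
  simp only [sharpMul, QuadraticMap.polarBilin_apply_apply, QuadraticMap.polar_comm]

theorem sharp_add (x y : J) : A.sharp (x + y) = A.sharp x + A.sharp y + A.sharpMul x y := by
  simp only [sharpMul, QuadraticMap.polarBilin_apply_apply, QuadraticMap.polar]
  abel

theorem sharpMul_self (x : J) : A.sharpMul x x = (2 : k) • A.sharp x := by
  simp only [sharpMul, QuadraticMap.polarBilin_apply_apply, QuadraticMap.polar_self]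
  rw [two_smul, two_smul]

theorem one_sharpMul (y : J) : A.sharpMul A.one y = A.tr y • A.one - y := A.one_sharp y

theorem tr_one (h2 : (2 : k) ≠ 0) : A.tr A.one = 3 := by
  change A.norm.deriv A.one A.one = 3
  rw [A.norm.deriv_self h2, A.norm_one, mul_one]

theorem T_one (h2 : (2 : k) ≠ 0) (y : J) : A.T A.one y = A.tr y := by
  have h := A.tr_one h2
  simp only [T, tr, CubicForm.bilinTrace, LinearMap.sub_apply, LinearMap.compl₁₂_apply,
    LinearMap.mul_apply', QuadraticMap.polarBilin_apply_apply, QuadraticMap.polar_self] at h ⊢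
  rw [h]
  simp only [CubicForm.trace, two_smul, LinearMap.add_apply]
  ring

theorem sharp_one (h2 : (2 : k) ≠ 0) : A.sharp A.one = A.one := by
  have h := A.one_sharpMul A.one
  rw [sharpMul_self, A.tr_one h2] at h
  have : (2 : k) • A.sharp A.one = (2 : k) • A.one := by rw [h]; module
  exact smul_right_injective J h2 this

theorem polarBilin_deriv (x y z : J) :
    A.norm.deriv.polarBilin x y z = A.T (A.sharpMul x y) z := by
  simp only [QuadraticMap.polarBilin_apply_apply, QuadraticMap.polar, LinearMap.sub_apply,
    A.deriv_norm, sharp_add, map_add, LinearMap.add_apply, T]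
  ring

theorem T_sharpMul_right_comm (x y z : J) :
    A.T (A.sharpMul x y) z = A.T (A.sharpMul x z) y := by
  rw [← A.polarBilin_deriv, CubicForm.polarBilin_deriv_right_comm, A.polarBilin_deriv]

theorem T_sharpMul_left (x y z : J) : A.T (A.sharpMul x y) z = A.T y (A.sharpMul x z) := by
  rw [T_sharpMul_right_comm, T_comm]

theorem tr_sharpMul (h2 : (2 : k) ≠ 0) (x y : J) :
    A.tr (A.sharpMul x y) = A.tr x * A.tr y - A.T x y := by
  rw [← A.T_one h2, ← A.T_sharpMul_left, A.sharpMul_comm, A.one_sharpMul, _root_.map_sub,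
    LinearMap.sub_apply, _root_.map_smul, LinearMap.smul_apply, A.T_one h2, smul_eq_mul]

theorem T_self (h2 : (2 : k) ≠ 0) (x : J) : A.T x x = A.tr x ^ 2 - 2 * A.S x := by
  have h := A.tr_sharpMul h2 x x
  rw [sharpMul_self, _root_.map_smul, smul_eq_mul] at h
  change _ = _ - 2 * A.tr (A.sharp x)
  linear_combination h

/-- The biquadratic component of `(x♯)♯ = N(x) x`. -/
theorem sharp_sharpMul (h2 : (2 : k) ≠ 0) (x y : J) :
    A.sharpMul (A.sharp x) (A.sharp y) + A.sharp (A.sharpMul x y) =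
      A.T (A.sharp x) y • y + A.T (A.sharp y) x • x := by
  -- Adding the identities at x + y and x - y leaves the part even in y; its bidegrees (4,0) and
  -- (0,4) are known, so (2,2) is isolated.
  have h1 := A.sharp_sharp (x + y)
  have h3 := A.sharp_sharp (x + -y)
  have hN : A.norm.toFun (-y) = - A.norm.toFun y := by
    have := A.norm.map_smul (-1) y
    rw [neg_one_smul] at this
    rw [this]; ring
  have hd (x y : J) : A.norm.deriv x y = A.T (A.sharp x) y := A.deriv_norm x y
  simp only [sharp_add, A.norm.map_add, hd, hN, QuadraticMap.map_neg, map_neg, map_add,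
    A.sharp_sharp, LinearMap.add_apply] at h1 h3
  refine smul_right_injective J h2 ?_
  change (2 : k) • _ = (2 : k) • _
  linear_combination (norm := module) h1 + h3

theorem sharpMul_sharpMul_sharp (h2 : (2 : k) ≠ 0) (x y z : J) :
    A.sharpMul (A.sharp x) (A.sharpMul y z) + A.sharpMul (A.sharpMul x y) (A.sharpMul x z) =
      A.T (A.sharp x) y • z + A.T (A.sharp x) z • y + A.T x (A.sharpMul y z) • x := by
  have h := A.sharp_sharpMul h2 x (y + z)
  have hy := A.sharp_sharpMul h2 x y
  have hz := A.sharp_sharpMul h2 x z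
  rw [A.T_comm x]
  simp only [sharp_add, map_add, LinearMap.add_apply] at h
  linear_combination (norm := module) h - hy - hz

/-- The full linearization of `(x♯)♯ = N(x) x`. -/
theorem sharpMul_linearized (h2 : (2 : k) ≠ 0) (x y z w : J) :
    A.sharpMul (A.sharpMul x z) (A.sharpMul w y) + A.sharpMul (A.sharpMul x w) (A.sharpMul z y) +
      A.sharpMul (A.sharpMul x y) (A.sharpMul z w) =
      A.T (A.sharpMul x z) w • y + A.T (A.sharpMul x z) y • w + A.T (A.sharpMul x w) y • z +
        A.T (A.sharpMul z w) y • x := by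
  have h := A.sharpMul_sharpMul_sharp h2 (x + z) w y
  have hx := A.sharpMul_sharpMul_sharp h2 x w y
  have hz := A.sharpMul_sharpMul_sharp h2 z w y
  simp only [sharp_add, map_add, LinearMap.add_apply] at h
  have e1 : A.T (A.sharpMul x w) y = A.T x (A.sharpMul w y) := by
    rw [A.sharpMul_comm, A.T_sharpMul_left]
  have e2 : A.T (A.sharpMul z w) y = A.T z (A.sharpMul w y) := by
    rw [A.sharpMul_comm, A.T_sharpMul_left]
  rw [e1, e2, A.sharpMul_comm (A.sharpMul x y)]
  linear_combination (norm := module) h - hx - hz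

end CubicJordanAlgebra

/-! ### Peirce decomposition at a rank-one idempotent -/

namespace CubicJordanAlgebra

variable {k J : Type*} [Field k] [AddCommGroup J] [Module k J] (A : CubicJordanAlgebra k J)

theorem U_apply (x y : J) : A.U x y = A.T x y • x - A.sharpMul (A.sharp x) y := rfl

theorem U₂_apply (x z y : J) :
    A.U₂ x z y = A.T x y • z + A.T z y • x - A.sharpMul (A.sharpMul x z) y := by
  simp only [U₂, LinearMap.sub_apply, U_apply, sharp_add, map_add, LinearMap.add_apply]
  module

/-- Rank-one elements of trace one; in characteristic different from two, these are the primitive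
idempotents. -/
structure IsRankOneIdempotent (e : J) : Prop where
  sharp_eq_zero : A.sharp e = 0
  tr_eq_one : A.tr e = 1

variable {A}

/-- When e♯ = 0, the Jordan square of `e` is T(e)e, so idempotency fixes the trace. -/
theorem IsPrimitiveIdempotent.isRankOneIdempotent (h2 : (2 : k) ≠ 0) {e : J}
    (he : A.IsPrimitiveIdempotent e) : A.IsRankOneIdempotent e := by
  refine ⟨he.2.2, ?_⟩
  have h := he.2.1
  have hs : A.sharp e = 0 := he.2.2
  rw [jordanMul, U₂_apply, sharpMul_self, hs, smul_zero, map_zero, LinearMap.zero_apply, sub_zero,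
    T_comm, A.T_one h2, ← two_smul k, smul_smul, inv_mul_cancel₀ h2, one_smul] at h
  have h' : (A.tr e - 1) • e = 0 := by rw [sub_smul, h, one_smul, sub_self]
  exact sub_eq_zero.1 ((smul_eq_zero.1 h').resolve_right he.1)

namespace IsRankOneIdempotent

variable (h2 : (2 : k) ≠ 0) {e : J} (he : A.IsRankOneIdempotent e)
include h2 he

theorem tr_sharpMul (x : J) : A.tr (A.sharpMul e x) = A.tr x - A.T e x := by
  rw [A.tr_sharpMul h2, he.tr_eq_one, one_mul]

omit h2 in
theorem sharpMul_self : A.sharpMul e e = 0 := by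
  rw [A.sharpMul_self, he.sharp_eq_zero, smul_zero]

theorem T_self : A.T e e = 1 := by
  rw [A.T_self h2, he.tr_eq_one, S, LinearMap.compQuadraticMap_apply, he.sharp_eq_zero, map_zero]
  ring

omit h2 in
theorem ne_zero : e ≠ 0 := by
  rintro rfl
  have := he.tr_eq_one
  rw [map_zero] at this
  exact zero_ne_one this

omit h2 in
theorem sharpMul_one : A.sharpMul e A.one = A.one - e := by
  rw [A.sharpMul_comm, A.one_sharpMul, he.tr_eq_one, one_smul]

omit h2 in
theorem sharpMul_compl : A.sharpMul e (A.one - e) = A.one - e := by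
  rw [map_sub, he.sharpMul_one, he.sharpMul_self, sub_zero]

theorem sharp_compl : A.sharp (A.one - e) = e := by
  have h := A.sharp_add (A.one - e) e
  rw [sub_add_cancel, he.sharp_eq_zero, A.sharp_one h2, A.sharpMul_comm, he.sharpMul_compl] at h
  linear_combination (norm := module) -h

theorem tr_compl : A.tr (A.one - e) = 2 := by
  rw [map_sub, A.tr_one h2, he.tr_eq_one]; norm_num

theorem T_compl (y : J) : A.T (A.one - e) y = A.tr (A.sharpMul e y) := by
  rw [map_sub, LinearMap.sub_apply, A.T_one h2, he.tr_sharpMul h2]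

omit h2 he in
theorem compl_sharpMul (y : J) :
    A.sharpMul (A.one - e) y = A.tr y • A.one - y - A.sharpMul e y := by
  rw [map_sub, LinearMap.sub_apply, A.one_sharpMul]

theorem sharpMul_left_sharpMul_sharpMul (y z : J) :
    A.sharpMul (A.sharpMul e y) (A.sharpMul e z) = A.T e (A.sharpMul y z) • e := by
  have h := A.sharpMul_sharpMul_sharp h2 e y z
  rw [he.sharp_eq_zero] at h
  simpa using h

/-- The case z = 1 of the preceding relation. It yields the eigenvalues of e ♯ that define the
Peirce spaces. -/
theorem sharpMul_sharpMul (y : J) :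
    A.sharpMul e (A.sharpMul e y) =
      A.tr (A.sharpMul e y) • (A.one - e) - A.sharpMul e y := by
  have h := he.sharpMul_left_sharpMul_sharpMul h2 y A.one
  rw [he.sharpMul_one, A.sharpMul_comm _ (A.one - e), compl_sharpMul, A.sharpMul_comm y,
    A.one_sharpMul, map_sub, _root_.map_smul, A.T_comm e A.one, A.T_one h2, he.tr_eq_one,
    smul_eq_mul, mul_one] at h
  have ht := he.tr_sharpMul h2 y
  rw [← ht] at h
  linear_combination (norm := module) -h

theorem U_compl (y : J) : A.U (A.one - e) y = A.sharpMul e (A.sharpMul e y) := by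
  rw [U_apply, he.sharp_compl h2, he.T_compl h2, he.sharpMul_sharpMul h2]

theorem T_eq_zero_of_sharpMul_eq_zero {x : J} (hx : A.sharpMul e x = 0) (ht : A.tr x = 0) :
    A.T e x = 0 := by
  have := he.tr_sharpMul h2 x
  rw [hx, ht, map_zero] at this
  linear_combination this

theorem mem_peirceHalf {x : J} : x ∈ A.peirceHalf e ↔ A.sharpMul e x = 0 ∧ A.tr x = 0 := by
  have hU (y : J) : A.U₂ e (A.one - e) y = y + A.sharpMul e y + A.T e y • (A.one - e) +
      (A.tr y - A.T e y) • e - A.tr y • A.one := by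
    rw [U₂_apply, he.sharpMul_compl, compl_sharpMul, he.T_compl h2, he.tr_sharpMul h2]
    module
  constructor
  · rintro ⟨y, rfl⟩
    have ht := he.tr_sharpMul h2 y
    rw [hU]
    simp only [map_add, map_sub, _root_.map_smul, he.sharpMul_one, he.sharpMul_self,
      he.sharpMul_sharpMul h2, ht, A.tr_one h2, he.tr_eq_one, smul_eq_mul]
    exact ⟨by module, by ring⟩
  · rintro ⟨hx, ht⟩
    refine ⟨x, ?_⟩
    rw [hU, hx, ht, he.T_eq_zero_of_sharpMul_eq_zero h2 hx ht]
    module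

omit h2 in
theorem T_eq_zero_of_sharpMul_eq_neg {x : J} (hx : A.sharpMul e x = -x) : A.T e x = 0 := by
  have h := A.T_sharpMul_left e e x
  rw [he.sharpMul_self, hx, map_zero, map_neg, LinearMap.zero_apply] at h
  linear_combination h

theorem tr_eq_zero_of_sharpMul_eq_neg {x : J} (hx : A.sharpMul e x = -x) : A.tr x = 0 := by
  have h := he.tr_sharpMul h2 x
  rw [hx, map_neg, he.T_eq_zero_of_sharpMul_eq_neg hx] at h
  refine (mul_eq_zero.1 (?_ : 2 * A.tr x = 0)).resolve_left h2
  linear_combination -h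

theorem mem_peirceZeroPerp {x : J} : x ∈ A.peirceZeroPerp e ↔ A.sharpMul e x = -x := by
  have hperp : x ∈ A.perp (A.one - e) ↔ A.tr (A.sharpMul e x) = 0 := by
    rw [← he.T_compl h2, A.T_comm]; rfl
  rw [peirceZeroPerp, Submodule.mem_inf, hperp]
  constructor
  · rintro ⟨⟨y, rfl⟩, ht⟩
    rw [he.U_compl h2] at ht ⊢
    have ht' : A.tr (A.sharpMul e (A.sharpMul e y)) = 0 := by
      rw [he.sharpMul_sharpMul h2 (A.sharpMul e y), map_sub, _root_.map_smul, he.tr_compl h2,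
        smul_eq_mul] at ht
      linear_combination ht
    rw [he.sharpMul_sharpMul h2 (A.sharpMul e y), ht', zero_smul, zero_sub]
  · intro hx
    refine ⟨⟨x, ?_⟩, ?_⟩
    · rw [he.U_compl h2, hx, map_neg, hx, neg_neg]
    · rw [hx, map_neg, he.tr_eq_zero_of_sharpMul_eq_neg h2 hx, neg_zero]

/-- The Peirce components of an element. -/
theorem exists_decomposition (x : J) : ∃ a b : k, ∃ w ∈ A.peirceZeroPerp e,
    ∃ m ∈ A.peirceHalf e, x = a • e + b • (A.one - e) + w + m := by
  obtain ⟨b, hb⟩ : ∃ b, A.tr (A.sharpMul e x) = 2 * b := ⟨_, (mul_div_cancel₀ _ h2).symm⟩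
  have ht := he.tr_sharpMul h2 x
  refine ⟨A.T e x, b, b • (A.one - e) - A.sharpMul e x, ?_,
    x + A.sharpMul e x - A.T e x • e - (2 * b) • (A.one - e), ?_, by module⟩
  · rw [he.mem_peirceZeroPerp h2]
    simp only [map_sub, _root_.map_smul, he.sharpMul_one, he.sharpMul_self,
      he.sharpMul_sharpMul h2, hb]
    module
  · rw [he.mem_peirceHalf h2]
    simp only [map_sub, map_add, _root_.map_smul, he.sharpMul_one, he.sharpMul_self,
      he.sharpMul_sharpMul h2, A.tr_one h2, he.tr_eq_one, smul_eq_mul, hb]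
    exact ⟨by module, by linear_combination hb - ht⟩

section

variable {w v x y : J} (hw : w ∈ A.peirceZeroPerp e) (hv : v ∈ A.peirceZeroPerp e)
  (hx : x ∈ A.peirceHalf e) (hy : y ∈ A.peirceHalf e)
include hw hx

theorem T_peirceZeroPerp_peirceHalf : A.T w x = 0 := by
  have h := A.T_sharpMul_left e w x
  rw [(he.mem_peirceHalf h2).1 hx |>.1, (he.mem_peirceZeroPerp h2).1 hw, map_zero, map_neg,
    LinearMap.neg_apply] at h
  linear_combination -h

theorem sharpMul_mem_peirceHalf : A.sharpMul w x ∈ A.peirceHalf e := by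
  have hw' := (he.mem_peirceZeroPerp h2).1 hw
  obtain ⟨hx', htx⟩ := (he.mem_peirceHalf h2).1 hx
  have hwx := he.T_peirceZeroPerp_peirceHalf h2 hw hx
  have ht : A.tr (A.sharpMul w x) = 0 := by
    rw [A.tr_sharpMul h2, hwx, htx]; ring
  -- In this instance the two copies of w ♯ x cancel, leaving e ♯ (w ♯ x) = 0.
  have h := A.sharpMul_linearized h2 e x w A.one
  rw [hw', he.sharpMul_one, hx', A.one_sharpMul, compl_sharpMul, ht, htx, A.T_comm _ A.one,
    A.T_one h2, he.T_compl h2, hx', A.sharpMul_comm w A.one, A.one_sharpMul,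
    he.tr_eq_zero_of_sharpMul_eq_neg h2 hw'] at h
  simp only [map_neg, LinearMap.neg_apply, map_zero, LinearMap.zero_apply, hwx, zero_smul,
    zero_sub, neg_zero, add_zero, neg_neg,
    he.tr_eq_zero_of_sharpMul_eq_neg h2 hw'] at h
  refine (he.mem_peirceHalf h2).2 ⟨?_, ht⟩
  linear_combination (norm := module) -h

-- Since e ♯ w = -w, the product (e ♯ w) ♯ (e ♯ w) is 2w♯, and any such product is a multiple of
-- `e`.
omit hx in
theorem sharp_of_mem_peirceZeroPerp : A.sharp w = A.S w • e := by
  have hw' := (he.mem_peirceZeroPerp h2).1 hw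
  have h := he.sharpMul_left_sharpMul_sharpMul h2 w w
  rw [hw', map_neg, map_neg, LinearMap.neg_apply, neg_neg, A.sharpMul_self, _root_.map_smul,
    smul_assoc] at h
  have h' : A.sharp w = A.T e (A.sharp w) • e := smul_right_injective J h2 h
  have hS : A.S w = A.T e (A.sharp w) := by
    change A.tr (A.sharp w) = _
    conv_lhs => rw [h']
    rw [_root_.map_smul, he.tr_eq_one, smul_eq_mul, mul_one]
  rw [hS, ← h']

/-- The Clifford relation. It is the adjoint identity at w, x, 1, in which w♯ = S(w)e annihilates x.
-/
theorem sharpMul_sharpMul_peirceHalf :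
    A.sharpMul w (A.sharpMul w x) = (-A.S w) • x := by
  have hw' := (he.mem_peirceZeroPerp h2).1 hw
  obtain ⟨hx', htx⟩ := (he.mem_peirceHalf h2).1 hx
  have h := A.sharpMul_sharpMul_sharp h2 w x A.one
  rw [he.sharp_of_mem_peirceZeroPerp h2 hw, A.sharpMul_comm x, A.sharpMul_comm w A.one,
    A.one_sharpMul, A.one_sharpMul, htx, he.tr_eq_zero_of_sharpMul_eq_neg h2 hw'] at h
  simp only [_root_.map_smul, LinearMap.smul_apply, zero_smul, zero_sub, map_neg, hx',
    he.T_peirceZeroPerp_peirceHalf h2 hw hx, he.T_eq_zero_of_sharpMul_eq_zero h2 hx' htx,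
    A.T_comm e A.one, A.T_one h2, he.tr_eq_one, smul_eq_mul, mul_one, mul_zero, neg_zero, smul_zero,
    zero_smul, zero_add, add_zero] at h
  rw [A.sharpMul_comm w (A.sharpMul w x), neg_smul, ← h, neg_neg]

omit hw in
/-- The adjoint of an element of `J_{1/2}` lies in `J₀`. -/
theorem sharp_of_mem_peirceHalf : ∃ v ∈ A.peirceZeroPerp e,
    A.sharp x = (2⁻¹ * A.S x) • (A.one - e) + v := by
  obtain ⟨hx', htx⟩ := (he.mem_peirceHalf h2).1 hx
  have hT : A.T x x = -2 * A.S x := by rw [A.T_self h2, htx]; ring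
  have hL : A.sharpMul e (A.sharp x) = A.S x • (A.one - e) - A.sharp x := by
    have h := A.sharpMul_linearized h2 e x x A.one
    rw [hx', he.sharpMul_one, compl_sharpMul, A.sharpMul_self, A.sharpMul_comm x A.one,
      A.one_sharpMul, htx, he.T_compl h2, hx'] at h
    simp only [map_zero, LinearMap.zero_apply, zero_smul, zero_add, zero_sub, add_zero,
      _root_.map_smul, map_neg, LinearMap.neg_apply, hT, smul_eq_mul] at h
    change _ = A.tr (A.sharp x) • _ - _
    have hS : A.S x = A.tr (A.sharp x) := rfl
    rw [hS] at h
    refine smul_right_injective J h2 ?_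
    change (2 : k) • _ = (2 : k) • _
    linear_combination (norm := module) -h
  obtain ⟨c, hc⟩ : ∃ c, A.S x = 2 * c := ⟨_, (mul_div_cancel₀ _ h2).symm⟩
  refine ⟨A.sharp x - c • (A.one - e), ?_, by rw [hc, inv_mul_cancel_left₀ h2]; module⟩
  rw [he.mem_peirceZeroPerp h2, map_sub, hL, _root_.map_smul, he.sharpMul_compl, hc]
  module

end

end IsRankOneIdempotent

end CubicJordanAlgebra

/-! ### Nondegeneracy of the trace form and nonvanishing of the Peirce spaces -/

namespace CubicJordanAlgebra

variable {k J : Type*} [Field k] [AddCommGroup J] [Module k J] {A : CubicJordanAlgebra k J}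

namespace IsRankOneIdempotent

variable (h2 : (2 : k) ≠ 0) {e : J} (he : A.IsRankOneIdempotent e)
include h2 he

theorem tr_peirceHalf {x : J} (hx : x ∈ A.peirceHalf e) : A.tr x = 0 :=
  ((he.mem_peirceHalf h2).1 hx).2

theorem tr_peirceZeroPerp {w : J} (hw : w ∈ A.peirceZeroPerp e) : A.tr w = 0 :=
  he.tr_eq_zero_of_sharpMul_eq_neg h2 ((he.mem_peirceZeroPerp h2).1 hw)

theorem T_peirceHalf {x : J} (hx : x ∈ A.peirceHalf e) : A.T e x = 0 :=
  he.T_eq_zero_of_sharpMul_eq_zero h2 ((he.mem_peirceHalf h2).1 hx).1 (he.tr_peirceHalf h2 hx)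

theorem T_peirceZeroPerp {w : J} (hw : w ∈ A.peirceZeroPerp e) : A.T e w = 0 :=
  he.T_eq_zero_of_sharpMul_eq_neg ((he.mem_peirceZeroPerp h2).1 hw)

theorem T_e_compl : A.T e (A.one - e) = 0 := by
  rw [map_sub, A.T_comm, A.T_one h2, he.tr_eq_one, he.T_self h2, sub_self]

theorem T_compl_peirceHalf {x : J} (hx : x ∈ A.peirceHalf e) : A.T (A.one - e) x = 0 := by
  rw [he.T_compl h2, ((he.mem_peirceHalf h2).1 hx).1, map_zero]

theorem T_compl_peirceZeroPerp {w : J} (hw : w ∈ A.peirceZeroPerp e) :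
    A.T (A.one - e) w = 0 := by
  rw [he.T_compl h2, (he.mem_peirceZeroPerp h2).1 hw, map_neg, he.tr_peirceZeroPerp h2 hw,
    neg_zero]

theorem compl_sharpMul_peirceHalf {x : J} (hx : x ∈ A.peirceHalf e) :
    A.sharpMul (A.one - e) x = -x := by
  rw [compl_sharpMul, ((he.mem_peirceHalf h2).1 hx).1, he.tr_peirceHalf h2 hx]
  module

theorem compl_sharpMul_peirceZeroPerp {w : J} (hw : w ∈ A.peirceZeroPerp e) :
    A.sharpMul (A.one - e) w = 0 := by
  rw [compl_sharpMul, (he.mem_peirceZeroPerp h2).1 hw, he.tr_peirceZeroPerp h2 hw]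
  module

theorem T_self_peirceZeroPerp {w : J} (hw : w ∈ A.peirceZeroPerp e) :
    A.T w w = -2 * A.S w := by
  rw [A.T_self h2, he.tr_peirceZeroPerp h2 hw]; ring

theorem T_self_peirceHalf {w : J} (hw : w ∈ A.peirceHalf e) : A.T w w = -2 * A.S w := by
  rw [A.T_self h2, he.tr_peirceHalf h2 hw]; ring

/-- The Peirce decomposition as a linear isomorphism. -/
theorem nonempty_peirceEquiv :
    Nonempty (((k × k) × A.peirceZeroPerp e × A.peirceHalf e) ≃ₗ[k] J) := by
  let φ : ((k × k) × A.peirceZeroPerp e × A.peirceHalf e) →ₗ[k] J :=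
    ((LinearMap.toSpanSingleton k J e).coprod
      (LinearMap.toSpanSingleton k J (A.one - e))).coprod
    ((A.peirceZeroPerp e).subtype.coprod (A.peirceHalf e).subtype)
  have hφ (a b w m) : φ ((a, b), w, m) = a • e + b • (A.one - e) + ((w : J) + m) := rfl
  refine ⟨LinearEquiv.ofBijective φ ⟨?_, fun x ↦ ?_⟩⟩
  · rw [← LinearMap.ker_eq_bot, LinearMap.ker_eq_bot']
    rintro ⟨⟨a, b⟩, ⟨w, hw⟩, ⟨m, hm⟩⟩ h
    rw [hφ] at h
    have h1 := congrArg (A.T e) h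
    simp only [map_add, _root_.map_smul, he.T_self h2, he.T_e_compl h2, map_zero,
      he.T_peirceHalf h2 hm, he.T_peirceZeroPerp h2 hw, smul_eq_mul] at h1
    have ha : a = 0 := by linear_combination h1
    have h3 := congrArg A.tr h
    simp only [map_add, _root_.map_smul, he.tr_eq_one, he.tr_compl h2, map_zero,
      he.tr_peirceHalf h2 hm, he.tr_peirceZeroPerp h2 hw, smul_eq_mul] at h3
    have hb : b = 0 := (mul_eq_zero.1 (by linear_combination h3 - ha : b * 2 = 0)).resolve_right h2
    have h4 := congrArg (A.sharpMul e) h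
    simp only [map_add, (he.mem_peirceZeroPerp h2).1 hw, ((he.mem_peirceHalf h2).1 hm).1,
      ha, hb, zero_smul, map_zero, zero_add, add_zero, neg_eq_zero] at h4
    subst ha hb h4
    simp only [zero_smul, zero_add] at h
    subst h
    rfl
  · obtain ⟨a, b, w, hw, m, hm, rfl⟩ := he.exists_decomposition h2 x
    exact ⟨((a, b), ⟨w, hw⟩, ⟨m, hm⟩), by rw [hφ, ← add_assoc]⟩

theorem finrank_add_finrank [FiniteDimensional k J] :
    Module.finrank k (A.peirceZeroPerp e) + Module.finrank k (A.peirceHalf e) + 2 =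
      Module.finrank k J := by
  obtain ⟨φ⟩ := he.nonempty_peirceEquiv h2
  have := φ.finrank_eq
  simp only [Module.finrank_prod, Module.finrank_self] at this
  omega

/-- The Peirce spaces are T-orthogonal, so T(w, ·) = 0 on J; also S(w) = 0, so w♯ = 0. Thus U_w = 0.
-/
theorem eq_zero_of_T_peirceZeroPerp (hnd : A.IsNondegenerate) {w : J}
    (hw : w ∈ A.peirceZeroPerp e) (h : ∀ v ∈ A.peirceZeroPerp e, A.T w v = 0) : w = 0 := by
  refine hnd w (LinearMap.ext fun x ↦ ?_)
  have hS : A.S w = 0 := by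
    have := he.T_self_peirceZeroPerp h2 hw
    rw [h w hw] at this
    refine (mul_eq_zero.1 (?_ : 2 * A.S w = 0)).resolve_left h2
    linear_combination this
  have hT : A.T w x = 0 := by
    obtain ⟨a, b, v, hv, m, hm, rfl⟩ := he.exists_decomposition h2 x
    simp only [map_add, _root_.map_smul, A.T_comm w e, A.T_comm w (A.one - e),
      he.T_peirceZeroPerp h2 hw, he.T_compl_peirceZeroPerp h2 hw, h v hv,
      he.T_peirceZeroPerp_peirceHalf h2 hw hm, smul_zero, add_zero]
  rw [U_apply, hT, he.sharp_of_mem_peirceZeroPerp h2 hw, hS]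
  simp

/-- Again T(x, ·) = 0 on J. Now S(x) = 0 only places x♯ in W, but 2T(x♯, u) = T(x, x ♯ u) = 0 then
gives x♯ = 0, and U_x = 0. -/
theorem eq_zero_of_T_peirceHalf (hnd : A.IsNondegenerate) {x : J}
    (hx : x ∈ A.peirceHalf e) (h : ∀ y ∈ A.peirceHalf e, A.T x y = 0) : x = 0 := by
  have hS : A.S x = 0 := by
    have := he.T_self_peirceHalf h2 hx
    rw [h x hx] at this
    refine (mul_eq_zero.1 (?_ : 2 * A.S x = 0)).resolve_left h2
    linear_combination this
  have hT (y : J) : A.T x y = 0 := by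
    obtain ⟨a, b, v, hv, m, hm, rfl⟩ := he.exists_decomposition h2 y
    simp only [map_add, _root_.map_smul, A.T_comm x e, A.T_comm x (A.one - e), A.T_comm x v,
      he.T_peirceHalf h2 hx, he.T_compl_peirceHalf h2 hx, h m hm,
      he.T_peirceZeroPerp_peirceHalf h2 hv hx, smul_zero, add_zero]
  obtain ⟨v, hv, hxv⟩ := he.sharp_of_mem_peirceHalf h2 hx
  rw [hS, mul_zero, zero_smul, zero_add] at hxv
  have hv0 : v = 0 := by
    refine he.eq_zero_of_T_peirceZeroPerp h2 hnd hv fun u _ ↦ ?_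
    have h1 := A.T_sharpMul_left x x u
    rw [hT, A.sharpMul_self, hxv, _root_.map_smul, LinearMap.smul_apply, smul_eq_mul] at h1
    exact (mul_eq_zero.1 h1).resolve_left h2
  refine hnd x (LinearMap.ext fun y ↦ ?_)
  rw [U_apply, hT, hxv, hv0]
  simp

/-- In a simple algebra of dimension at least two, `J_{1/2} ≠ 0`. -/
theorem peirceHalf_ne_bot (hs : A.IsSimple) (hdim : Module.finrank k J ≠ 1) :
    A.peirceHalf e ≠ ⊥ := by
  intro hbot
  -- If J_{1/2} = 0, the line ke is a nonzero ideal, hence all of J, against the dimension.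
  have hI : A.IsIdeal (k ∙ e) := by
    intro x y hy
    obtain ⟨c, rfl⟩ := Submodule.mem_span_singleton.1 hy
    obtain ⟨a, b, w, hw, m, hm, rfl⟩ := he.exists_decomposition h2 x
    obtain rfl : m = 0 := by rw [hbot] at hm; exact hm
    have hw' := (he.mem_peirceZeroPerp h2).1 hw
    constructor
    · refine Submodule.mem_span_singleton.2 ⟨c * a ^ 2, ?_⟩
      rw [_root_.map_smul, U_apply, A.sharpMul_comm _ e]
      simp only [add_zero, sharp_add, QuadraticMap.map_smul, he.sharp_eq_zero, he.sharp_compl h2,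
        he.sharp_of_mem_peirceZeroPerp h2 hw, map_add, _root_.map_smul, LinearMap.add_apply,
        LinearMap.smul_apply, he.sharpMul_compl, hw', he.sharpMul_self, map_neg,
        he.compl_sharpMul_peirceZeroPerp h2 hw, map_zero, A.T_comm _ e, he.T_self h2,
        he.T_e_compl h2, he.T_peirceZeroPerp h2 hw, smul_eq_mul]
      module
    · refine Submodule.mem_span_singleton.2 ⟨A.T (c • e) (a • e + b • (A.one - e) + w + 0) * c, ?_⟩
      rw [U_apply, QuadraticMap.map_smul, he.sharp_eq_zero]
      simp [mul_smul]
  rcases hs.2 _ hI with h | h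
  · exact he.ne_zero (Submodule.span_singleton_eq_bot.1 h)
  · refine hdim ?_
    rw [← finrank_top, ← h, finrank_span_singleton he.ne_zero]

/-- Traces in (x♯)♯ = N(x)x: the left side is a multiple of `e`, the right side has trace zero. -/
theorem S_sharp_component {x v : J} (hx : x ∈ A.peirceHalf e) (hv : v ∈ A.peirceZeroPerp e)
    (h : A.sharp x = (2⁻¹ * A.S x) • (A.one - e) + v) :
    (2⁻¹ * A.S x) ^ 2 + A.S v = 0 := by
  have h1 := A.sharp_sharp x
  have h3 := congrArg A.tr h1
  rw [h] at h3
  simp only [sharp_add, QuadraticMap.map_smul, he.sharp_compl h2,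
    he.sharp_of_mem_peirceZeroPerp h2 hv, map_add, _root_.map_smul, LinearMap.smul_apply,
    he.compl_sharpMul_peirceZeroPerp h2 hv, map_zero, he.tr_eq_one, he.tr_peirceHalf h2 hx,
    smul_eq_mul] at h3
  linear_combination h3

omit he in
theorem T_eq_zero_of_T_self_eq_zero {x y : J} (hx : A.T x x = 0) (hy : A.T y y = 0)
    (hxy : A.T (x + y) (x + y) = 0) : A.T x y = 0 := by
  refine (mul_eq_zero.1 (?_ : 2 * A.T x y = 0)).resolve_left h2
  simp only [map_add, LinearMap.add_apply, A.T_comm y x, hx, hy] at hxy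
  linear_combination hxy

theorem peirceZeroPerp_ne_bot (hnd : A.IsNondegenerate) (hM : A.peirceHalf e ≠ ⊥) :
    A.peirceZeroPerp e ≠ ⊥ := by
  intro hbot
  obtain ⟨x, hx, hx0⟩ := (Submodule.ne_bot_iff _).1 hM
  have hT (y : J) (hy : y ∈ A.peirceHalf e) : A.T y y = 0 := by
    obtain ⟨v, hv, hyv⟩ := he.sharp_of_mem_peirceHalf h2 hy
    have h := he.S_sharp_component h2 hy hv hyv
    obtain rfl : v = 0 := by rw [hbot] at hv; exact hv
    rw [QuadraticMap.map_zero, add_zero] at h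
    have hS := (mul_eq_zero.1 (pow_eq_zero_iff two_ne_zero |>.1 h)).resolve_left (inv_ne_zero h2)
    rw [he.T_self_peirceHalf h2 hy, hS, mul_zero]
  exact hx0 (he.eq_zero_of_T_peirceHalf h2 hnd hx fun y hy ↦
    T_eq_zero_of_T_self_eq_zero h2 (hT x hx) (hT y hy) (hT _ (add_mem hx hy)))

/-! ### Excluding a one-dimensional W -/

section

variable {w : J} (hw : w ∈ A.peirceZeroPerp e) (hS : A.S w = -1)
  (hspan : ∀ v ∈ A.peirceZeroPerp e, ∃ c : k, v = c • w)
include hw hS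

theorem half_compl_sub : A.IsRankOneIdempotent ((2 : k)⁻¹ • (A.one - e - w)) := by
  have hd : A.one - e - w = (A.one - e) + (-1 : k) • w := by module
  constructor
  · rw [QuadraticMap.map_smul, hd, sharp_add, QuadraticMap.map_smul, he.sharp_compl h2,
      he.sharp_of_mem_peirceZeroPerp h2 hw, hS, _root_.map_smul,
      he.compl_sharpMul_peirceZeroPerp h2 hw]
    module
  · rw [_root_.map_smul, map_sub, he.tr_compl h2, he.tr_peirceZeroPerp h2 hw, sub_zero,
      smul_eq_mul, inv_mul_cancel₀ h2]

include hspan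

/-- M falls into the (-1)-eigenspace of the new idempotent, so nothing of it is left in the new half
space. This will contradict `peirceHalf_ne_bot`. -/
theorem peirceHalf_half_compl_sub (hM : ∀ x ∈ A.peirceHalf e, A.sharpMul w x = x) :
    A.peirceHalf ((2 : k)⁻¹ • (A.one - e - w)) = ⊥ := by
  rw [eq_bot_iff]
  intro y hy
  obtain ⟨h1, h3⟩ := ((he.half_compl_sub h2 hw hS).mem_peirceHalf h2).1 hy
  rw [_root_.map_smul, LinearMap.smul_apply, smul_eq_zero_iff_right (inv_ne_zero h2)] at h1
  obtain ⟨a, b, v, hv, m, hm, rfl⟩ := he.exists_decomposition h2 y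
  obtain ⟨c, rfl⟩ := hspan v hv
  simp only [map_add, _root_.map_smul, he.tr_eq_one, he.tr_compl h2, he.tr_peirceHalf h2 hm,
    he.tr_peirceZeroPerp h2 hw, smul_eq_mul] at h3
  have hs1 : A.sharpMul (A.one - e - w) e = A.one - e + w := by
    rw [A.sharpMul_comm, map_sub, he.sharpMul_compl, (he.mem_peirceZeroPerp h2).1 hw]
    module
  have hs2 : A.sharpMul (A.one - e - w) (A.one - e) = (2 : k) • e := by
    rw [A.sharpMul_comm, map_sub, A.sharpMul_self, he.sharp_compl h2,
      he.compl_sharpMul_peirceZeroPerp h2 hw, sub_zero]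
  have hs3 : A.sharpMul (A.one - e - w) w = (2 : k) • e := by
    rw [map_sub, LinearMap.sub_apply, he.compl_sharpMul_peirceZeroPerp h2 hw, A.sharpMul_self,
      he.sharp_of_mem_peirceZeroPerp h2 hw, hS]
    module
  have hs4 : A.sharpMul (A.one - e - w) m = (-2 : k) • m := by
    rw [map_sub, LinearMap.sub_apply, he.compl_sharpMul_peirceHalf h2 hm, hM m hm]
    module
  simp only [map_add, _root_.map_smul, hs1, hs2, hs3, hs4] at h1
  have h4 := congrArg (A.T e) h1
  simp only [map_add, _root_.map_smul, he.T_self h2, he.T_e_compl h2, map_zero,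
    he.T_peirceHalf h2 hm, he.T_peirceZeroPerp h2 hw, smul_eq_mul] at h4
  have h5 := congrArg A.tr h1
  simp only [map_add, _root_.map_smul, he.tr_eq_one, he.tr_compl h2, map_zero,
    he.tr_peirceHalf h2 hm, he.tr_peirceZeroPerp h2 hw, smul_eq_mul] at h5
  have ha : a = 0 := (mul_eq_zero.1 (by linear_combination h5 - h4 : a * 2 = 0)).resolve_right h2
  have hb : b = 0 := (mul_eq_zero.1 (by linear_combination h3 - ha : b * 2 = 0)).resolve_right h2
  have hc : c = 0 :=
    (mul_eq_zero.1 (by linear_combination h4 - 2 * hb : c * 2 = 0)).resolve_right h2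
  subst ha hb hc
  have hm0 : m = 0 := by
    refine (smul_eq_zero.1 (?_ : (-2 : k) • m = 0)).resolve_left (neg_ne_zero.2 h2)
    linear_combination (norm := module) h1
  simp [hm0]

/-- With x♯ = d(1-e) + cw, `S_sharp_component` says c² = d², while T(x, x) = -4d and T(x, w ♯ x) =
4c. -/
theorem T_sharpMul_self_sq {x : J} (hx : x ∈ A.peirceHalf e) :
    A.T x (A.sharpMul w x) ^ 2 = A.T x x ^ 2 := by
  obtain ⟨v, hv, hxv⟩ := he.sharp_of_mem_peirceHalf h2 hx
  have h := he.S_sharp_component h2 hx hv hxv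
  obtain ⟨c, rfl⟩ := hspan v hv
  obtain ⟨d, hd⟩ : ∃ d, A.S x = 2 * d := ⟨_, (mul_div_cancel₀ _ h2).symm⟩
  rw [hd, inv_mul_cancel_left₀ h2] at h hxv
  rw [QuadraticMap.map_smul, hS, smul_eq_mul] at h
  have h1 := A.T_sharpMul_left x x w
  rw [A.sharpMul_self, hxv, A.sharpMul_comm x w] at h1
  simp only [map_add, _root_.map_smul, LinearMap.smul_apply, LinearMap.add_apply,
    he.T_compl_peirceZeroPerp h2 hw, he.T_self_peirceZeroPerp h2 hw, hS, smul_eq_mul] at h1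
  rw [he.T_self_peirceHalf h2 hx, ← h1, hd]
  linear_combination (-16) * h

/-- The eigenspaces of w ♯ are T-orthogonal, so `T_sharpMul_self_sq` at p + m reads (T(p,p) -
T(m,m))² = (T(p,p) + T(m,m))². -/
theorem T_mul_T_eq_zero {p m : J} (hp : p ∈ A.peirceHalf e) (hm : m ∈ A.peirceHalf e)
    (hwp : A.sharpMul w p = p) (hwm : A.sharpMul w m = -m) : A.T p p = 0 ∨ A.T m m = 0 := by
  have hpm : A.T p m = 0 := by
    have h := A.T_sharpMul_left w p m
    rw [hwp, hwm, map_neg] at h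
    refine (mul_eq_zero.1 (?_ : 2 * A.T p m = 0)).resolve_left h2
    linear_combination h
  have h := he.T_sharpMul_self_sq h2 hw hS hspan (add_mem hp hm)
  simp only [map_add, map_neg, hwp, hwm, LinearMap.add_apply, A.T_comm m p, hpm] at h
  have h4 : (2 : k) * 2 ≠ 0 := mul_ne_zero h2 h2
  refine mul_eq_zero.1 ((mul_eq_zero.1 (?_ : (2 * 2) * (A.T p p * A.T m m) = 0)).resolve_left h4)
  linear_combination -h

-- The element x + w ♯ x lies in the (+1)-eigenspace, where T vanishes. Self-adjointness of w ♯
-- makes it T-orthogonal to all of M, hence zero.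
omit hspan in
theorem sharpMul_eq_neg_of_T_self_eq_zero (hnd : A.IsNondegenerate)
    (h : ∀ p ∈ A.peirceHalf e, A.sharpMul w p = p → A.T p p = 0) {x : J}
    (hx : x ∈ A.peirceHalf e) : A.sharpMul w x = -x := by
  have hww (y : J) (hy : y ∈ A.peirceHalf e) : A.sharpMul w (A.sharpMul w y) = y := by
    rw [he.sharpMul_sharpMul_peirceHalf h2 hw hy, hS, neg_neg, one_smul]
  have hmem (y : J) (hy : y ∈ A.peirceHalf e) : y + A.sharpMul w y ∈ A.peirceHalf e :=
    add_mem hy (he.sharpMul_mem_peirceHalf h2 hw hy)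
  have hfix (y : J) (hy : y ∈ A.peirceHalf e) :
      A.sharpMul w (y + A.sharpMul w y) = y + A.sharpMul w y := by
    rw [map_add, hww y hy, add_comm]
  have key : x + A.sharpMul w x = 0 := by
    refine he.eq_zero_of_T_peirceHalf h2 hnd (hmem x hx) fun y hy ↦ ?_
    have h1 : A.T (x + A.sharpMul w x) (y + A.sharpMul w y) = 0 :=
      T_eq_zero_of_T_self_eq_zero h2 (h _ (hmem x hx) (hfix x hx)) (h _ (hmem y hy) (hfix y hy))
        (h _ (add_mem (hmem x hx) (hmem y hy)) (by rw [map_add, hfix x hx, hfix y hy]))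
    have h3 := A.T_sharpMul_left w (x + A.sharpMul w x) y
    rw [hfix x hx] at h3
    rw [map_add, ← h3] at h1
    refine (mul_eq_zero.1 (?_ : 2 * A.T (x + A.sharpMul w x) y = 0)).resolve_left h2
    linear_combination h1
  linear_combination (norm := module) key

end

/-- Scale w to S(w) = -1, so that w ♯ squares to one on M. T vanishes on one of its eigenspaces,
which is then zero; after a change of sign w ♯ is the identity on M, and (1 - e - w)/2 has zero half
space. -/
theorem finrank_peirceZeroPerp_ne_one [IsAlgClosed k] (hnd : A.IsNondegenerate) (hs : A.IsSimple)
    (hdim : Module.finrank k J ≠ 1) : Module.finrank k (A.peirceZeroPerp e) ≠ 1 := by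
  intro hW
  obtain ⟨⟨w₀, hw₀⟩, hne, hspan₀⟩ := finrank_eq_one_iff'.1 hW
  have hspan₁ (v : J) (hv : v ∈ A.peirceZeroPerp e) : ∃ c : k, v = c • w₀ := by
    obtain ⟨c, hc⟩ := hspan₀ ⟨v, hv⟩
    exact ⟨c, (congrArg Subtype.val hc).symm⟩
  have hS₀ : A.S w₀ ≠ 0 := by
    intro h0
    refine hne (Subtype.ext (he.eq_zero_of_T_peirceZeroPerp h2 hnd hw₀ fun v hv ↦ ?_))
    obtain ⟨c, rfl⟩ := hspan₁ v hv
    rw [_root_.map_smul, he.T_self_peirceZeroPerp h2 hw₀, h0, mul_zero, smul_zero]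
  obtain ⟨r, hr⟩ := IsAlgClosed.exists_eq_mul_self (-(A.S w₀)⁻¹)
  have hr0 : r ≠ 0 := by
    rintro rfl
    rw [mul_zero, neg_eq_zero] at hr
    exact inv_ne_zero hS₀ hr
  have main (w : J) (hw : w ∈ A.peirceZeroPerp e) (hS : A.S w = -1)
      (hspan : ∀ v ∈ A.peirceZeroPerp e, ∃ c : k, v = c • w)
      (hM : ∀ x ∈ A.peirceHalf e, A.sharpMul w x = x) : False :=
    (he.half_compl_sub h2 hw hS).peirceHalf_ne_bot h2 hs hdim
      (he.peirceHalf_half_compl_sub h2 hw hS hspan hM)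
  have hw : r • w₀ ∈ A.peirceZeroPerp e := Submodule.smul_mem _ _ hw₀
  have hS : A.S (r • w₀) = -1 := by
    rw [QuadraticMap.map_smul, ← hr, smul_eq_mul, neg_mul, inv_mul_cancel₀ hS₀]
  have hspan (v : J) (hv : v ∈ A.peirceZeroPerp e) : ∃ c : k, v = c • r • w₀ := by
    obtain ⟨c, rfl⟩ := hspan₁ v hv
    exact ⟨c * r⁻¹, by rw [smul_smul, inv_mul_cancel_right₀ hr0]⟩
  generalize r • w₀ = w at hw hS hspan
  have hw' : -w ∈ A.peirceZeroPerp e := neg_mem hw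
  have hS' : A.S (-w) = -1 := by rw [QuadraticMap.map_neg, hS]
  have hspan' (v : J) (hv : v ∈ A.peirceZeroPerp e) : ∃ c : k, v = c • -w := by
    obtain ⟨c, rfl⟩ := hspan v hv
    exact ⟨-c, by module⟩
  by_cases h : ∀ p ∈ A.peirceHalf e, A.sharpMul w p = p → A.T p p = 0
  · refine main (-w) hw' hS' hspan' fun x hx ↦ ?_
    rw [map_neg, LinearMap.neg_apply, he.sharpMul_eq_neg_of_T_self_eq_zero h2 hw hS hnd h hx,
      neg_neg]
  · push Not at h
    obtain ⟨p, hp, hwp, hTp⟩ := h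
    refine main w hw hS hspan fun x hx ↦ ?_
    have h' : ∀ m ∈ A.peirceHalf e, A.sharpMul (-w) m = m → A.T m m = 0 := by
      intro m hm hwm
      rw [map_neg, LinearMap.neg_apply] at hwm
      exact (he.T_mul_T_eq_zero h2 hw hS hspan hp hm hwp (neg_eq_iff_eq_neg.1 hwm)).resolve_left hTp
    have := he.sharpMul_eq_neg_of_T_self_eq_zero h2 hw' hS' hnd h' hx
    rwa [map_neg, LinearMap.neg_apply, neg_inj] at this

end IsRankOneIdempotent

end CubicJordanAlgebra

/-! ### Algebra of three anticommuting square roots of one -/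

section CliffordTriple

variable {k R : Type*} [Field k] [Ring R] [Algebra k R]

/-- Three pairwise anticommuting elements of square one. -/
structure IsCliffordTriple (e₁ e₂ e₃ : R) : Prop where
  sq₁ : e₁ * e₁ = 1
  sq₂ : e₂ * e₂ = 1
  sq₃ : e₃ * e₃ = 1
  anti₁₂ : e₂ * e₁ = -(e₁ * e₂)
  anti₂₃ : e₃ * e₂ = -(e₂ * e₃)
  anti₃₁ : e₁ * e₃ = -(e₃ * e₁)

/-- Linear combination of the eight monomials in three anticommuting elements. -/
def cliffordComb (e₁ e₂ e₃ : R) (a b₁ b₂ b₃ c₁ c₂ c₃ d : k) : R :=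
  a • 1 + b₁ • e₁ + b₂ • e₂ + b₃ • e₃ + c₁ • (e₂ * e₃) + c₂ • (e₃ * e₁) + c₃ • (e₁ * e₂) +
    d • (e₁ * e₂ * e₃)

namespace IsCliffordTriple

variable {e₁ e₂ e₃ : R} (h : IsCliffordTriple e₁ e₂ e₃)
include h

/-- The relations and the bivectors e₂e₃, e₃e₁, e₁e₂ are ordered cyclically, so computations for e₁
transfer to e₂ and e₃. -/
theorem rotate : IsCliffordTriple e₂ e₃ e₁ :=
  ⟨h.sq₂, h.sq₃, h.sq₁, h.anti₂₃, h.anti₃₁, h.anti₁₂⟩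

theorem volume_rotate : e₂ * e₃ * e₁ = e₁ * e₂ * e₃ := by
  rw [mul_assoc, ← neg_neg (e₃ * e₁), ← h.anti₃₁, mul_neg, ← mul_assoc, h.anti₁₂, neg_mul, neg_neg]

theorem volume_commute : e₁ * (e₁ * e₂ * e₃) = e₁ * e₂ * e₃ * e₁ := by
  rw [← mul_assoc, ← mul_assoc, h.sq₁, one_mul, ← h.volume_rotate, mul_assoc,
    h.sq₁, mul_one]

theorem volume_sq : e₁ * e₂ * e₃ * (e₁ * e₂ * e₃) = -1 := by
  calc e₁ * e₂ * e₃ * (e₁ * e₂ * e₃) = e₁ * e₂ * e₃ * (e₂ * e₃ * e₁) := by rw [h.volume_rotate]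
    _ = e₁ * e₂ * (e₃ * e₂) * e₃ * e₁ := by simp only [mul_assoc]
    _ = -(e₁ * (e₂ * e₂) * (e₃ * e₃) * e₁) := by
      rw [h.anti₂₃]; simp only [mul_assoc, mul_neg, neg_mul]
    _ = -1 := by rw [h.sq₂, h.sq₃, mul_one, mul_one, h.sq₁]

theorem eq_mul_volume : e₃ = e₂ * e₁ * (e₁ * e₂ * e₃) := by
  rw [← mul_assoc, ← mul_assoc, mul_assoc e₂ e₁ e₁, h.sq₁, mul_one, h.sq₂, one_mul]

theorem comb_rotate (a b₁ b₂ b₃ c₁ c₂ c₃ d : k) :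
    cliffordComb e₁ e₂ e₃ a b₁ b₂ b₃ c₁ c₂ c₃ d = cliffordComb e₂ e₃ e₁ a b₂ b₃ b₁ c₂ c₃ c₁ d := by
  unfold cliffordComb
  rw [h.volume_rotate]
  abel

theorem mul_comb (a b₁ b₂ b₃ c₁ c₂ c₃ d : k) :
    e₁ * cliffordComb e₁ e₂ e₃ a b₁ b₂ b₃ c₁ c₂ c₃ d =
      cliffordComb e₁ e₂ e₃ b₁ a c₃ (-c₂) d (-b₃) b₂ c₁ := by
  have h1 : e₁ * (e₃ * e₁) = -e₃ := by
    rw [← mul_assoc, h.anti₃₁, neg_mul, mul_assoc, h.sq₁, mul_one]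
  have h2 : e₁ * (e₁ * e₂) = e₂ := by rw [← mul_assoc, h.sq₁, one_mul]
  have h3 : e₁ * (e₁ * e₂ * e₃) = e₂ * e₃ := by
    rw [← mul_assoc, ← mul_assoc, h.sq₁, one_mul]
  simp only [cliffordComb, mul_add, mul_smul_comm, mul_one, h.sq₁, h.anti₃₁, h1, h2, h3,
    ← mul_assoc e₁ e₂ e₃]
  module

theorem mul_comb₂ (a b₁ b₂ b₃ c₁ c₂ c₃ d : k) :
    e₂ * cliffordComb e₁ e₂ e₃ a b₁ b₂ b₃ c₁ c₂ c₃ d =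
      cliffordComb e₁ e₂ e₃ b₂ (-c₃) a c₁ b₃ d (-b₁) c₂ := by
  rw [h.comb_rotate, h.rotate.mul_comb, ← h.comb_rotate]

theorem mul_comb₃ (a b₁ b₂ b₃ c₁ c₂ c₃ d : k) :
    e₃ * cliffordComb e₁ e₂ e₃ a b₁ b₂ b₃ c₁ c₂ c₃ d =
      cliffordComb e₁ e₂ e₃ b₃ c₂ (-c₁) a (-b₂) b₁ d c₃ := by
  rw [h.comb_rotate, h.rotate.mul_comb₂, ← h.comb_rotate]

theorem comb_mul (a b₁ b₂ b₃ c₁ c₂ c₃ d : k) :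
    cliffordComb e₁ e₂ e₃ a b₁ b₂ b₃ c₁ c₂ c₃ d * e₁ =
      cliffordComb e₁ e₂ e₃ b₁ a (-c₃) c₂ d b₃ (-b₂) c₁ := by
  have h1 : e₁ * e₂ * e₁ = -e₂ := by
    rw [mul_assoc, h.anti₁₂, mul_neg, ← mul_assoc, h.sq₁, one_mul]
  have h2 : e₃ * e₁ * e₁ = e₃ := by rw [mul_assoc, h.sq₁, mul_one]
  have h3 : e₁ * e₂ * e₃ * e₁ = e₂ * e₃ := by
    rw [← h.volume_rotate, mul_assoc, h.sq₁, mul_one]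
  simp only [cliffordComb, add_mul, smul_mul_assoc, one_mul, h.sq₁, h.anti₁₂, h1, h2, h3,
    h.volume_rotate]
  module

theorem comb_conj (a b₁ b₂ b₃ c₁ c₂ c₃ d : k) :
    e₁ * cliffordComb e₁ e₂ e₃ a b₁ b₂ b₃ c₁ c₂ c₃ d * e₁ =
      cliffordComb e₁ e₂ e₃ a b₁ (-b₂) (-b₃) c₁ (-c₂) (-c₃) d := by
  rw [h.mul_comb, h.comb_mul]

/-- Average with the conjugate by e₁, which flips exactly e₂, e₃, e₃e₁ and e₁e₂. -/
theorem comb_eq_zero_aux (h2 : (2 : k) ≠ 0) {a b₁ b₂ b₃ c₁ c₂ c₃ d : k}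
    (h0 : cliffordComb e₁ e₂ e₃ a b₁ b₂ b₃ c₁ c₂ c₃ d = 0) :
    cliffordComb e₁ e₂ e₃ a b₁ 0 0 c₁ 0 0 d = 0 := by
  have h1 := h.comb_conj a b₁ b₂ b₃ c₁ c₂ c₃ d
  rw [h0, mul_zero, zero_mul] at h1
  refine (smul_eq_zero.1 (?_ : (2 : k) • _ = (0 : R))).resolve_left h2
  unfold cliffordComb at h0 h1 ⊢
  linear_combination (norm := module) h0 - h1

theorem comb_scalar_part (h2 : (2 : k) ≠ 0) {a b₁ b₂ b₃ c₁ c₂ c₃ d : k}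
    (hz : ∀ a d : k, a • (1 : R) + d • (e₁ * e₂ * e₃) = 0 → a = 0 ∧ d = 0)
    (h0 : cliffordComb e₁ e₂ e₃ a b₁ b₂ b₃ c₁ c₂ c₃ d = 0) : a = 0 ∧ d = 0 := by
  have h1 := h.comb_eq_zero_aux h2 h0
  rw [h.comb_rotate] at h1
  have h3 := h.rotate.comb_eq_zero_aux h2 h1
  refine hz a d ?_
  rw [← h3, cliffordComb, h.volume_rotate]
  module

/-- Multiplication by e₁ carries the coefficients of e₁ and e₂e₃ to those of 1 and the volume
element. -/
theorem comb_vector_part (h2 : (2 : k) ≠ 0) {a b₁ b₂ b₃ c₁ c₂ c₃ d : k}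
    (hz : ∀ a d : k, a • (1 : R) + d • (e₁ * e₂ * e₃) = 0 → a = 0 ∧ d = 0)
    (h0 : cliffordComb e₁ e₂ e₃ a b₁ b₂ b₃ c₁ c₂ c₃ d = 0) : b₁ = 0 ∧ c₁ = 0 := by
  have h1 := h.mul_comb a b₁ b₂ b₃ c₁ c₂ c₃ d
  rw [h0, mul_zero] at h1
  exact h.comb_scalar_part h2 hz h1.symm

/-- The eight monomials are linearly independent as soon as the volume element is not a scalar. -/
theorem comb_eq_zero (h2 : (2 : k) ≠ 0) {a b₁ b₂ b₃ c₁ c₂ c₃ d : k}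
    (hz : ∀ a d : k, a • (1 : R) + d • (e₁ * e₂ * e₃) = 0 → a = 0 ∧ d = 0)
    (h0 : cliffordComb e₁ e₂ e₃ a b₁ b₂ b₃ c₁ c₂ c₃ d = 0) :
    (a = 0 ∧ d = 0) ∧ (b₁ = 0 ∧ c₁ = 0) ∧ (b₂ = 0 ∧ c₂ = 0) ∧ (b₃ = 0 ∧ c₃ = 0) := by
  have hz' := h.volume_rotate.symm ▸ hz
  have hz'' := h.rotate.volume_rotate.symm ▸ hz'
  have h1 := h0
  rw [h.comb_rotate] at h1
  have h3 := h1
  rw [h.rotate.comb_rotate] at h3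
  exact ⟨h.comb_scalar_part h2 hz h0, h.comb_vector_part h2 hz h0,
    h.rotate.comb_vector_part h2 hz' h1, h.rotate.rotate.comb_vector_part h2 hz'' h3⟩

end IsCliffordTriple

end CliffordTriple

/-! ### Modules over Clifford algebras: dimension constraints and monomials -/

section CliffordModule

variable {k W M : Type*} [Field k] [AddCommGroup W] [Module k W] [AddCommGroup M] [Module k M]
  {q : QuadraticForm k W}

theorem QuadraticForm.exists_orthonormal_basis [IsAlgClosed k] [FiniteDimensional k W]
    (h2 : (2 : k) ≠ 0) (hq : ∀ w, (∀ v, QuadraticMap.polar q w v = 0) → w = 0) {n : ℕ}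
    (hn : Module.finrank k W = n) :
    ∃ b : Module.Basis (Fin n) k W, (∀ i, q (b i) = 1) ∧
      ∀ i j, i ≠ j → QuadraticMap.polar q (b i) (b j) = 0 := by
  subst hn
  let : Invertible (2 : k) := invertibleOfNonzero h2
  have hsep : (QuadraticMap.associated q).SeparatingLeft := by
    intro w hw
    refine hq w fun v ↦ ?_
    rw [← QuadraticMap.polarBilin_apply_apply, ← QuadraticMap.two_nsmul_associated k q,
      LinearMap.smul_apply, LinearMap.smul_apply]
    exact (congrArg (2 • ·) (hw v)).trans (smul_zero 2)
  obtain ⟨φ⟩ := QuadraticForm.equivalent_weightedSumSquares_of_isAlgClosed q hsep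
  have hval (x : Fin (Module.finrank k W) → k) : q (φ.symm x) = ∑ i, x i * x i := by
    rw [φ.symm.map_app, QuadraticMap.weightedSumSquares_apply]
    simp
  refine ⟨(Pi.basisFun k _).map φ.symm.toLinearEquiv, fun i ↦ ?_, fun i j hij ↦ ?_⟩
  · change q (φ.symm _) = 1
    rw [hval]
    simp [Pi.single_apply]
  · change QuadraticMap.polar q (φ.symm _) (φ.symm _) = 0
    rw [QuadraticMap.polar, ← map_add φ.symm, hval, hval, hval, ← Finset.sum_sub_distrib,
      ← Finset.sum_sub_distrib]
    refine Finset.sum_eq_zero fun l _ ↦ ?_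
    by_cases h : l = i
    · subst h
      simp [hij]
    · simp [h]

variable {f : W →ₗ[k] Module.End k M} (hf : ∀ w, f w * f w = algebraMap k _ (q w))
include hf

theorem cliffordModule_mul_add_mul (v w : W) :
    f v * f w + f w * f v = algebraMap k _ (QuadraticMap.polar q v w) := by
  have h := hf (v + w)
  simp only [map_add, mul_add, add_mul, hf] at h
  rw [QuadraticMap.polar, map_sub, map_sub, ← h]
  abel

theorem cliffordModule_apply_apply (v w : W) (x : M) :
    f v (f w x) = QuadraticMap.polar q v w • x - f w (f v x) := by
  have h := congrArg (fun g : Module.End k M ↦ g x) (cliffordModule_mul_add_mul hf v w)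
  simp only [LinearMap.add_apply, Module.End.mul_apply, Module.algebraMap_end_apply] at h
  rw [← h, add_sub_cancel_right]

theorem cliffordModule_injective [Nontrivial M]
    (hq : ∀ w, (∀ v, QuadraticMap.polar q w v = 0) → w = 0) : Function.Injective f := by
  rw [← LinearMap.ker_eq_bot, LinearMap.ker_eq_bot']
  intro w hw
  refine hq w fun v ↦ ?_
  have h := cliffordModule_mul_add_mul hf w v
  rw [hw, zero_mul, mul_zero, add_zero] at h
  exact ((map_eq_zero_iff _ (algebraMap k (Module.End k M)).injective).1 h.symm)

theorem finrank_le_of_cliffordModule [FiniteDimensional k M] [Nontrivial M]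
    (hq : ∀ w, (∀ v, QuadraticMap.polar q w v = 0) → w = 0) :
    Module.finrank k W ≤ Module.finrank k M * Module.finrank k M := by
  rw [← Module.finrank_linearMap k k M M]
  exact LinearMap.finrank_le_finrank_of_injective (cliffordModule_injective hf hq)

/-- Determinants in f_v f_w = -f_w f_v: both factors are invertible, so (-1)^dim M = 1. -/
theorem even_finrank_of_cliffordModule [FiniteDimensional k M] (h2 : (2 : k) ≠ 0) {v w : W}
    (hv : q v = 1) (hw : q w = 1) (hvw : QuadraticMap.polar q v w = 0) :
    Even (Module.finrank k M) := by
  have h := cliffordModule_mul_add_mul hf v w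
  rw [hvw, map_zero, add_eq_zero_iff_eq_neg, ← neg_one_smul k] at h
  have hd (u : W) (hu : q u = 1) : LinearMap.det (f u) ≠ 0 := by
    intro h0
    have := congrArg LinearMap.det (hf u)
    rw [map_mul, h0, hu, map_one, map_one, mul_zero] at this
    exact zero_ne_one this
  have h1 := congrArg LinearMap.det h
  rw [LinearMap.det_smul, map_mul, map_mul] at h1
  by_contra hodd
  rw [(Nat.not_even_iff_odd.1 hodd).neg_one_pow] at h1
  refine mul_ne_zero h2 (mul_ne_zero (hd v hv) (hd w hw)) ?_
  linear_combination h1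

omit hf in
theorem isCliffordTriple_of_orthonormal {R : Type*} [Ring R] [Algebra k R] {g : W →ₗ[k] R}
    (hg : ∀ w, g w * g w = algebraMap k _ (q w)) {b : Fin 3 → W} (hb : ∀ i, q (b i) = 1)
    (hbb : ∀ i j, i ≠ j → QuadraticMap.polar q (b i) (b j) = 0) :
    IsCliffordTriple (g (b 0)) (g (b 1)) (g (b 2)) := by
  have hsq (i) : g (b i) * g (b i) = 1 := by rw [hg, hb, map_one]
  have hanti (i j) (hij : i ≠ j) : g (b i) * g (b j) = -(g (b j) * g (b i)) := by
    have h := hg (b i + b j)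
    have hp := hbb i j hij
    rw [QuadraticMap.polar, sub_sub, sub_eq_zero] at hp
    simp only [map_add, mul_add, add_mul, hp, hg] at h
    linear_combination (norm := abel) h
  exact ⟨hsq 0, hsq 1, hsq 2, hanti 1 0 (by decide), hanti 2 1 (by decide), hanti 0 2 (by decide)⟩

omit hf in
theorem CliffordAlgebra.exists_eq_cliffordComb {b : Module.Basis (Fin 3) k W}
    (hb : ∀ i, q (b i) = 1) (hbb : ∀ i j, i ≠ j → QuadraticMap.polar q (b i) (b j) = 0)
    (x : CliffordAlgebra q) : ∃ a b₁ b₂ b₃ c₁ c₂ c₃ d : k,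
      x = cliffordComb (ι q (b 0)) (ι q (b 1)) (ι q (b 2)) a b₁ b₂ b₃ c₁ c₂ c₃ d := by
  have ht := isCliffordTriple_of_orthonormal (g := ι q) (ι_sq_scalar q) hb hbb
  induction x using CliffordAlgebra.left_induction with
  | algebraMap r =>
    refine ⟨r, 0, 0, 0, 0, 0, 0, 0, ?_⟩
    rw [cliffordComb, Algebra.algebraMap_eq_smul_one]
    module
  | add x y hx hy =>
    obtain ⟨a, b₁, b₂, b₃, c₁, c₂, c₃, d, rfl⟩ := hx
    obtain ⟨a', b₁', b₂', b₃', c₁', c₂', c₃', d', rfl⟩ := hy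
    refine ⟨a + a', b₁ + b₁', b₂ + b₂', b₃ + b₃', c₁ + c₁', c₂ + c₂', c₃ + c₃', d + d', ?_⟩
    unfold cliffordComb
    module
  | ι_mul x m hx =>
    obtain ⟨a, b₁, b₂, b₃, c₁, c₂, c₃, d, rfl⟩ := hx
    rw [← b.sum_repr m, Fin.sum_univ_three, map_add, map_add, map_smul, map_smul, map_smul,
      add_mul, add_mul, smul_mul_assoc, smul_mul_assoc, smul_mul_assoc, ht.mul_comb,
      ht.mul_comb₂, ht.mul_comb₃]
    generalize b.repr m 0 = r
    generalize b.repr m 1 = s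
    generalize b.repr m 2 = t
    refine ⟨r * b₁ + s * b₂ + t * b₃, r * a - s * c₃ + t * c₂, r * c₃ + s * a - t * c₁,
      -r * c₂ + s * c₁ + t * a, r * d + s * b₃ - t * b₂, -r * b₃ + s * d + t * b₁,
      r * b₂ - s * b₁ + t * d, r * c₁ + s * c₂ + t * c₃, ?_⟩
    unfold cliffordComb
    module

end CliffordModule

/-! ### Self-adjoint modules in three generators: faithfulness and splitting -/

section CliffordModule

variable {k W M : Type*} [Field k] [AddCommGroup W] [Module k W] [AddCommGroup M] [Module k M]
  {q : QuadraticForm k W}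

namespace IsCliffordTriple

variable {e₁ e₂ e₃ : Module.End k M} (h : IsCliffordTriple e₁ e₂ e₃)
include h

/-- The volume element is skew-adjoint for any form making the generators self-adjoint. -/
theorem volume_not_scalar (h2 : (2 : k) ≠ 0) {B : LinearMap.BilinForm k M} (hB : B ≠ 0)
    (hB₁ : ∀ x y, B (e₁ x) y = B x (e₁ y)) (hB₂ : ∀ x y, B (e₂ x) y = B x (e₂ y))
    (hB₃ : ∀ x y, B (e₃ x) y = B x (e₃ y)) (a d : k)
    (h0 : a • (1 : Module.End k M) + d • (e₁ * e₂ * e₃) = 0) : a = 0 ∧ d = 0 := by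
  have hrev : e₃ * e₂ * e₁ = -(e₁ * e₂ * e₃) := by
    rw [h.anti₂₃, neg_mul, h.volume_rotate]
  have hskew (x y : M) : B ((e₁ * e₂ * e₃) x) y = -B x ((e₁ * e₂ * e₃) y) := by
    rw [← map_neg, ← LinearMap.neg_apply, ← hrev]
    simp only [Module.End.mul_apply, hB₁, hB₂, hB₃]
  obtain ⟨x, y, hxy⟩ : ∃ x y, B x y ≠ 0 := by
    by_contra! hc
    exact hB (LinearMap.ext₂ hc)
  have happ (v : M) : a • v + d • (e₁ * e₂ * e₃) v = 0 := congrArg (fun g : Module.End k M ↦ g v) h0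
  -- The relation is used in each slot of B; by skewness the d-terms cancel in the sum, leaving 2a
  -- B(x, y) = 0.
  have h1 := congrArg (fun v ↦ B v y) (happ x)
  have h3 := congrArg (B x) (happ y)
  simp only [map_add, map_smul, LinearMap.add_apply, LinearMap.smul_apply, hskew, map_zero,
    LinearMap.zero_apply, smul_eq_mul] at h1 h3
  have ha : a = 0 := by
    have : (2 * a) * B x y = 0 := by linear_combination h1 + h3
    exact (mul_eq_zero.1 ((mul_eq_zero.1 this).resolve_right hxy)).resolve_left h2
  refine ⟨ha, ?_⟩
  by_contra hd
  have hz : e₁ * e₂ * e₃ = 0 := by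
    rw [ha, zero_smul, zero_add] at h0
    exact (smul_eq_zero.1 h0).resolve_left hd
  have h4 := h.volume_sq
  rw [hz, mul_zero, eq_comm, neg_eq_zero] at h4
  apply hxy
  have : x = 0 := congrArg (fun g : Module.End k M ↦ g x) h4
  rw [this, map_zero, LinearMap.zero_apply]

variable (hz : ∀ a d : k, a • (1 : Module.End k M) + d • (e₁ * e₂ * e₃) = 0 → a = 0 ∧ d = 0)
include hz

theorem exists_eigenvector {i ε : k} (hi : i * i = -1) (hε : ε * ε = 1) :
    ∃ s : M, s ≠ 0 ∧ (e₁ * e₂ * e₃) s = i • s ∧ e₁ s = ε • s := by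
  have hsq (x : M) : (e₁ * e₂ * e₃) ((e₁ * e₂ * e₃) x) = -x :=
    congrArg (fun g : Module.End k M ↦ g x) h.volume_sq
  have hc₁ (x : M) : (e₁ * e₂ * e₃) (e₁ x) = e₁ ((e₁ * e₂ * e₃) x) :=
    (congrArg (fun g : Module.End k M ↦ g x) h.volume_commute).symm
  have hc₂ (x : M) : (e₁ * e₂ * e₃) (e₂ x) = e₂ ((e₁ * e₂ * e₃) x) := by
    rw [← h.volume_rotate]
    exact (congrArg (fun g : Module.End k M ↦ g x) h.rotate.volume_commute).symm
  have hs₁ (x : M) : e₁ (e₁ x) = x := congrArg (fun g : Module.End k M ↦ g x) h.sq₁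
  have hs₂ (x : M) : e₂ (e₂ x) = x := congrArg (fun g : Module.End k M ↦ g x) h.sq₂
  have ha (x : M) : e₂ (e₁ x) = -e₁ (e₂ x) := congrArg (fun g : Module.End k M ↦ g x) h.anti₁₂
  generalize e₁ * e₂ * e₃ = z at hz hsq hc₁ hc₂ ⊢
  -- (z - i)(z + i) = 0, so without an i-eigenvector z would be the scalar -i.
  obtain ⟨s, hs, hzs⟩ : ∃ s, s ≠ 0 ∧ z s = i • s := by
    by_contra! hcon
    refine one_ne_zero (hz i 1 (LinearMap.ext fun x ↦ ?_)).2
    by_contra hx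
    refine hcon _ hx ?_
    simp only [LinearMap.add_apply, LinearMap.smul_apply, Module.End.one_apply, map_add, map_smul,
      one_smul, hsq, smul_add, smul_smul, hi]
    module
  -- Project s to the ε-eigenspace of e₁. If the projection vanishes, e₂ s works: e₂ anticommutes
  -- with e₁ and commutes with z.
  by_cases h0 : s + ε • e₁ s = 0
  · refine ⟨e₂ s, fun h0 ↦ hs ?_, ?_, ?_⟩
    · rw [← hs₂ s, h0, map_zero]
    · rw [hc₂, hzs, map_smul]
    · have h1 : e₁ s = (-ε) • s := by
        have h4 := congrArg (ε • ·) h0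
        simp only [smul_add, smul_smul, hε, smul_zero] at h4
        linear_combination (norm := module) h4
      have h3 := ha s
      rw [h1, map_smul] at h3
      linear_combination (norm := module) h3
  · refine ⟨_, h0, ?_, ?_⟩
    · rw [map_add, map_smul, hc₁, hzs, map_smul]
      module
    · rw [map_add, map_smul, hs₁, smul_add, smul_smul, hε]
      module

/-- On a four-dimensional module, the generators act on the two eigenspaces of the volume element
by the Pauli matrices and by their negatives. -/
theorem exists_pauli_basis [IsAlgClosed k] (h2 : (2 : k) ≠ 0) (hM : Module.finrank k M = 4) :
    ∃ s₁ s₂ t₁ t₂ : M, Submodule.span k {s₁, s₂, t₁, t₂} = ⊤ ∧ ∀ a₁ a₂ a₃ : k, ∃ a b c : k,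
      a₁ • e₁ s₁ + a₂ • e₂ s₁ + a₃ • e₃ s₁ = a • s₁ + b • s₂ ∧
      a₁ • e₁ s₂ + a₂ • e₂ s₂ + a₃ • e₃ s₂ = c • s₁ - a • s₂ ∧
      a₁ • e₁ t₁ + a₂ • e₂ t₁ + a₃ • e₃ t₁ = -(a • t₁ + b • t₂) ∧
      a₁ • e₁ t₂ + a₂ • e₂ t₂ + a₃ • e₃ t₂ = -(c • t₁ - a • t₂) := by
  obtain ⟨i, hi⟩ := IsAlgClosed.exists_eq_mul_self (-1 : k)
  have hi' : -i * -i = -1 := by rw [neg_mul_neg, ← hi]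
  obtain ⟨s, hs, hzs, hes⟩ := h.exists_eigenvector hz hi.symm (one_mul 1)
  obtain ⟨t, ht, hzt, het⟩ := h.exists_eigenvector hz hi' (neg_mul_neg 1 1 |>.trans (one_mul 1))
  have hi0 : i ≠ 0 := by
    rintro rfl
    rw [mul_zero, neg_eq_zero] at hi
    exact one_ne_zero hi
  have hc₂ (x : M) : (e₁ * e₂ * e₃) (e₂ x) = e₂ ((e₁ * e₂ * e₃) x) := by
    rw [← h.volume_rotate]
    exact (congrArg (fun g : Module.End k M ↦ g x) h.rotate.volume_commute).symm
  have hs₂ (x : M) : e₂ (e₂ x) = x := congrArg (fun g : Module.End k M ↦ g x) h.sq₂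
  have ha (x : M) : e₁ (e₂ x) = -e₂ (e₁ x) := by
    rw [eq_neg_iff_add_eq_zero, add_comm, ← eq_neg_iff_add_eq_zero]
    exact congrArg (fun g : Module.End k M ↦ g x) h.anti₁₂
  have he₃ (x : M) : e₃ x = e₂ (e₁ ((e₁ * e₂ * e₃) x)) :=
    congrArg (fun g : Module.End k M ↦ g x) h.eq_mul_volume
  have h₁s : e₁ (e₂ s) = -e₂ s := by rw [ha, hes, one_smul]
  have h₁t : e₁ (e₂ t) = e₂ t := by rw [ha, het, neg_smul, one_smul, map_neg, neg_neg]
  have h₃s : e₃ s = i • e₂ s := by rw [he₃, hzs, map_smul, hes, one_smul, map_smul]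
  have h₃t : e₃ t = i • e₂ t := by rw [he₃, hzt, map_smul, het, map_smul, map_smul]; module
  have h₃s' : e₃ (e₂ s) = -i • s := by
    rw [he₃, hc₂, hzs, map_smul, map_smul, h₁s, map_smul, map_neg, hs₂]; module
  have h₃t' : e₃ (e₂ t) = -i • t := by
    rw [he₃, hc₂, hzt, map_smul, map_smul, h₁t, map_smul, hs₂]
  -- Taking e₁ t = -t and the sign in -e₂ t makes the matrices on t exactly the negatives of those
  -- on s.
  refine ⟨s, e₂ s, t, -e₂ t, ?_, fun a₁ a₂ a₃ ↦ ⟨a₁, a₂ + i * a₃, a₂ - i * a₃, ?_, ?_, ?_, ?_⟩⟩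
  · have hli : LinearIndependent k ![s, e₂ s, t, -e₂ t] := by
      rw [Fintype.linearIndependent_iff]
      intro g hg
      simp only [Fin.sum_univ_four, Matrix.cons_val] at hg
      have hsz : e₂ s ≠ 0 := fun h0 ↦ hs (by rw [← hs₂ s, h0, map_zero])
      have htz : e₂ t ≠ 0 := fun h0 ↦ ht (by rw [← hs₂ t, h0, map_zero])
      have hz1 := congrArg (e₁ * e₂ * e₃) hg
      simp only [map_add, map_smul, map_neg, map_zero, hc₂, hzs, hzt] at hz1
      -- The eigenvalues ±i of the volume element separate the s-part from the t-part; those of e₁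
      -- then separate within each.
      have split : g 0 • s + g 1 • e₂ s = 0 ∧ g 2 • t + g 3 • -e₂ t = 0 := by
        constructor
        · refine (smul_eq_zero.1 (?_ : (2 * i) • _ = (0 : M))).resolve_left (mul_ne_zero h2 hi0)
          linear_combination (norm := module) i • hg + hz1
        · refine (smul_eq_zero.1 (?_ : (2 * i) • _ = (0 : M))).resolve_left (mul_ne_zero h2 hi0)
          linear_combination (norm := module) i • hg - hz1
      obtain ⟨hgs, hgt⟩ := split
      have hgs' := congrArg e₁ hgs
      have hgt' := congrArg e₁ hgt
      simp only [map_add, map_smul, map_neg, map_zero, hes, het, h₁s, h₁t] at hgs' hgt'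
      have hdouble {x : M} (hx : x ≠ 0) {c : k} (hc : (2 * c) • x = 0) : c = 0 :=
        (mul_eq_zero.1 ((smul_eq_zero.1 hc).resolve_right hx)).resolve_left h2
      exact fun j ↦ match j with
        | 0 => hdouble hs (by linear_combination (norm := module) hgs + hgs')
        | 1 => hdouble hsz (by linear_combination (norm := module) hgs - hgs')
        | 2 => hdouble ht (by linear_combination (norm := module) hgt - hgt')
        | 3 => hdouble htz (by linear_combination (norm := module) -hgt - hgt')
    have := hli.span_eq_top_of_card_eq_finrank (by rw [hM, Fintype.card_fin])
    rwa [Matrix.range_cons, Matrix.range_cons, Matrix.range_cons, Matrix.range_cons,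
      Matrix.range_empty, Set.union_empty] at this
  · rw [hes, h₃s]; module
  · rw [h₁s, hs₂, h₃s']; module
  · rw [het, h₃t]; module
  · rw [map_neg, map_neg, map_neg, h₁t, hs₂, h₃t']; module

end IsCliffordTriple

variable {f : W →ₗ[k] Module.End k M} (hf : ∀ w, f w * f w = algebraMap k _ (q w))
  (hq : ∀ w, (∀ v, QuadraticMap.polar q w v = 0) → w = 0)
include hf

theorem cliffordModule_volume_not_scalar (h2 : (2 : k) ≠ 0) {B : LinearMap.BilinForm k M}
    (hB : B ≠ 0) (hBf : ∀ w x y, B (f w x) y = B x (f w y)) {b : Fin 3 → W}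
    (hb : ∀ i, q (b i) = 1) (hbb : ∀ i j, i ≠ j → QuadraticMap.polar q (b i) (b j) = 0) (a d : k)
    (h0 : a • (1 : Module.End k M) + d • (f (b 0) * f (b 1) * f (b 2)) = 0) : a = 0 ∧ d = 0 :=
  (isCliffordTriple_of_orthonormal hf hb hbb).volume_not_scalar h2 hB (hBf _) (hBf _) (hBf _) a d h0

include hq

/-- A self-adjoint module over the Clifford algebra of a three-dimensional space is faithful. -/
theorem exists_cliffordAlgebra_equiv_adjoin [IsAlgClosed k] (h2 : (2 : k) ≠ 0)
    (hW : Module.finrank k W = 3) {B : LinearMap.BilinForm k M}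
    (hB : B ≠ 0) (hBf : ∀ w x y, B (f w x) y = B x (f w y)) :
    ∃ e : CliffordAlgebra q ≃ₐ[k] Algebra.adjoin k (Set.range f),
      ∀ w, (e (CliffordAlgebra.ι q w) : Module.End k M) = f w := by
  have : FiniteDimensional k W := .of_finrank_pos (by omega)
  obtain ⟨b, hb, hbb⟩ := QuadraticForm.exists_orthonormal_basis h2 hq hW
  have ht := isCliffordTriple_of_orthonormal hf hb hbb
  let φ := CliffordAlgebra.lift q ⟨f, hf⟩
  have hφι (w) : φ (CliffordAlgebra.ι q w) = f w := CliffordAlgebra.lift_ι_apply f hf w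
  have hinj : Function.Injective φ := by
    rw [injective_iff_map_eq_zero]
    intro x hx
    obtain ⟨a, b₁, b₂, b₃, c₁, c₂, c₃, d, rfl⟩ := CliffordAlgebra.exists_eq_cliffordComb hb hbb x
    have h0 : cliffordComb (f (b 0)) (f (b 1)) (f (b 2)) a b₁ b₂ b₃ c₁ c₂ c₃ d = 0 := by
      rw [← hx]
      simp only [cliffordComb, map_add, map_smul, map_mul, map_one, hφι]
    obtain ⟨⟨rfl, rfl⟩, ⟨rfl, rfl⟩, ⟨rfl, rfl⟩, rfl, rfl⟩ := ht.comb_eq_zero h2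
      (cliffordModule_volume_not_scalar hf h2 hB hBf hb hbb) h0
    simp [cliffordComb]
  refine ⟨(AlgEquiv.ofInjective φ hinj).trans
    (Subalgebra.equivOfEq _ _ (CliffordAlgebra.range_lift f hf)), fun w ↦ hφι w⟩

/-- Spanning V by the s_i + f_u t_i also covers isotropic u, that is, the case where the form
degenerates on the span of w₂ and w₄. -/
theorem exists_cliffordModule_splitting [IsAlgClosed k] (h2 : (2 : k) ≠ 0)
    (hW : Module.finrank k W = 3) (hM : Module.finrank k M = 4) {B : LinearMap.BilinForm k M}
    (hB : B ≠ 0) (hBf : ∀ w x y, B (f w x) y = B x (f w y)) {w₁ w₂ w₄ : W}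
    (hspan : Submodule.span k {w₁, w₂, w₄} = ⊤) :
    ∃ V : Submodule k M, Module.finrank k V = 2 ∧ V.map (f w₂) ≤ V ∧ V.map (f w₄) ≤ V ∧
      Module.finrank k (V.map (f w₁)) = 2 ∧ Disjoint V (V.map (f w₁)) ∧ V ⊔ V.map (f w₁) = ⊤ := by
  have : FiniteDimensional k W := .of_finrank_pos (by omega)
  have : FiniteDimensional k M := .of_finrank_pos (by omega)
  obtain ⟨b, hb, hbb⟩ := QuadraticForm.exists_orthonormal_basis h2 hq hW
  obtain ⟨s₁, s₂, t₁, t₂, htop, hact⟩ :=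
    (isCliffordTriple_of_orthonormal hf hb hbb).exists_pauli_basis
      (cliffordModule_volume_not_scalar hf h2 hB hBf hb hbb) h2 hM
  have hact' (w : W) : ∃ a b c : k, f w s₁ = a • s₁ + b • s₂ ∧ f w s₂ = c • s₁ - a • s₂ ∧
      f w t₁ = -(a • t₁ + b • t₂) ∧ f w t₂ = -(c • t₁ - a • t₂) := by
    have hw (x : M) : f w x = b.repr w 0 • f (b 0) x + b.repr w 1 • f (b 1) x +
        b.repr w 2 • f (b 2) x := by
      have := congrArg (fun v ↦ f v x) (b.sum_repr w).symm
      simpa only [Fin.sum_univ_three, map_add, map_smul, LinearMap.add_apply,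
        LinearMap.smul_apply] using this
    simp only [hw]
    exact hact _ _ _
  clear hact
  obtain ⟨u, hu0, hu₂, hu₄⟩ : ∃ u : W, u ≠ 0 ∧ QuadraticMap.polar q w₂ u = 0 ∧
      QuadraticMap.polar q w₄ u = 0 := by
    have hker : LinearMap.ker ((q.polarBilin w₂).prod (q.polarBilin w₄)) ≠ ⊥ :=
      LinearMap.ker_ne_bot_of_finrank_lt (by rw [Module.finrank_prod, Module.finrank_self]; omega)
    obtain ⟨u, hu, hu0⟩ := (Submodule.ne_bot_iff _).1 hker
    exact ⟨u, hu0, congrArg Prod.fst hu, congrArg Prod.snd hu⟩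
  have hu₁ : QuadraticMap.polar q w₁ u ≠ 0 := by
    intro h0
    refine hu0 (hq u fun v ↦ ?_)
    have hle : Submodule.span k {w₁, w₂, w₄} ≤ LinearMap.ker (q.polarBilin u) := by
      rw [Submodule.span_le]
      rintro x (rfl | rfl | rfl) <;>
        exact (QuadraticMap.polar_comm _ _ _).trans ‹_›
    rw [hspan] at hle
    exact hle (Submodule.mem_top (x := v))
  have hv (w : W) : ∃ a b c : k,
      f w (s₁ + f u t₁) = a • (s₁ + f u t₁) + b • (s₂ + f u t₂) + QuadraticMap.polar q w u • t₁ ∧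
      f w (s₂ + f u t₂) = c • (s₁ + f u t₁) - a • (s₂ + f u t₂) +
        QuadraticMap.polar q w u • t₂ := by
    obtain ⟨a, b, c, h1, h3, h4, h5⟩ := hact' w
    refine ⟨a, b, c, ?_, ?_⟩
    · rw [map_add, cliffordModule_apply_apply hf w u, h1, h4, map_neg, map_add, map_smul, map_smul]
      module
    · rw [map_add, cliffordModule_apply_apply hf w u, h3, h5, map_neg, map_sub, map_smul, map_smul]
      module
  -- f_u preserves the span of the t_i, so once the t_i are reached, s_i = v_i - f_u t_i is too.
  obtain ⟨a, b, c, -, -, h4, h5⟩ := hact' u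
  clear hact'
  generalize hv₁ : s₁ + f u t₁ = v₁ at *
  generalize hv₂ : s₂ + f u t₂ = v₂ at *
  have hm₁ : v₁ ∈ Submodule.span k {v₁, v₂} := Submodule.subset_span (by simp)
  have hm₂ : v₂ ∈ Submodule.span k {v₁, v₂} := Submodule.subset_span (by simp)
  have hstab (w : W) (hw : QuadraticMap.polar q w u = 0) :
      (Submodule.span k {v₁, v₂}).map (f w) ≤ Submodule.span k {v₁, v₂} := by
    obtain ⟨a, b, c, h1, h3⟩ := hv w
    rw [hw, zero_smul, add_zero] at h1 h3
    rw [Submodule.map_span_le]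
    rintro x (rfl | rfl)
    · rw [h1]
      exact add_mem (Submodule.smul_mem _ _ hm₁) (Submodule.smul_mem _ _ hm₂)
    · rw [h3]
      exact sub_mem (Submodule.smul_mem _ _ hm₁) (Submodule.smul_mem _ _ hm₂)
  have hsup : Submodule.span k {v₁, v₂} ⊔ (Submodule.span k {v₁, v₂}).map (f w₁) = ⊤ := by
    set V := Submodule.span k {v₁, v₂}
    obtain ⟨a', b', c', h1, h3⟩ := hv w₁
    have hV {x : M} (hx : x ∈ V) : x ∈ V ⊔ V.map (f w₁) := Submodule.mem_sup_left hx
    have hfV {x : M} (hx : x ∈ V) : f w₁ x ∈ V ⊔ V.map (f w₁) :=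
      Submodule.mem_sup_right (Submodule.mem_map_of_mem hx)
    have ht₁ : t₁ ∈ V ⊔ V.map (f w₁) := by
      rw [← Submodule.smul_mem_iff _ hu₁, ← add_sub_cancel_left (a' • v₁ + b' • v₂) (_ • t₁), ← h1]
      exact sub_mem (hfV hm₁)
        (hV (add_mem (Submodule.smul_mem _ _ hm₁) (Submodule.smul_mem _ _ hm₂)))
    have ht₂ : t₂ ∈ V ⊔ V.map (f w₁) := by
      rw [← Submodule.smul_mem_iff _ hu₁, ← add_sub_cancel_left (c' • v₁ - a' • v₂) (_ • t₂), ← h3]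
      exact sub_mem (hfV hm₂)
        (hV (sub_mem (Submodule.smul_mem _ _ hm₁) (Submodule.smul_mem _ _ hm₂)))
    rw [eq_top_iff, ← htop, Submodule.span_le]
    rintro x (rfl | rfl | rfl | rfl)
    · rw [← eq_sub_iff_add_eq] at hv₁
      rw [hv₁, h4, SetLike.mem_coe]
      exact sub_mem (hV hm₁) (neg_mem (add_mem (Submodule.smul_mem _ _ ht₁)
        (Submodule.smul_mem _ _ ht₂)))
    · rw [← eq_sub_iff_add_eq] at hv₂
      rw [hv₂, h5, SetLike.mem_coe]
      exact sub_mem (hV hm₂) (neg_mem (sub_mem (Submodule.smul_mem _ _ ht₁)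
        (Submodule.smul_mem _ _ ht₂)))
    · exact ht₁
    · exact ht₂
  -- Two subspaces of dimension at most two that span a four-dimensional space are two-dimensional
  -- and independent.
  have hrank : Module.finrank k (Submodule.span k {v₁, v₂}) ≤ 2 := by
    classical
    have := finrank_span_finset_le_card (R := k) ({v₁, v₂} : Finset M)
    rw [Finset.coe_pair] at this
    exact this.trans Finset.card_le_two
  have hrank' := (Submodule.finrank_map_le (f w₁) (Submodule.span k {v₁, v₂})).trans hrank
  have hadd := Submodule.finrank_sup_add_finrank_inf_eq (Submodule.span k {v₁, v₂})
    ((Submodule.span k {v₁, v₂}).map (f w₁))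
  rw [hsup, finrank_top, hM] at hadd
  refine ⟨Submodule.span k {v₁, v₂}, by omega, hstab w₂ hu₂, hstab w₄ hu₄, by omega, ?_, hsup⟩
  rw [disjoint_iff, ← Submodule.finrank_eq_zero (R := k)]
  omega

end CliffordModule

/-! ### The Clifford action on the half space and the main theorem -/

namespace CubicJordanAlgebra

variable {k J : Type*} [Field k] [AddCommGroup J] [Module k J] {A : CubicJordanAlgebra k J}

namespace IsRankOneIdempotent

variable (h2 : (2 : k) ≠ 0) {e : J} (he : A.IsRankOneIdempotent e)

/-- The action `π ↦ (ρ ↦ π ♯ ρ)` of `J₀ ∩ π₃^⊥` on `J_{1/2}`. -/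
def cliffordAction : A.peirceZeroPerp e →ₗ[k] Module.End k (A.peirceHalf e) :=
  LinearMap.mk₂ k
    (fun w x ↦ ⟨A.sharpMul (w : J) (x : J), he.sharpMul_mem_peirceHalf h2 w.2 x.2⟩)
    (fun w v x ↦ Subtype.ext (by simp)) (fun c w x ↦ Subtype.ext (by simp))
    (fun w x y ↦ Subtype.ext (by simp)) (fun c w x ↦ Subtype.ext (by simp))

theorem cliffordAction_apply (w : A.peirceZeroPerp e) (x : A.peirceHalf e) :
    (he.cliffordAction h2 w x : J) = A.sharpMul (w : J) (x : J) := rfl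

theorem cliffordAction_mul_self (w : A.peirceZeroPerp e) :
    he.cliffordAction h2 w * he.cliffordAction h2 w = algebraMap k _ (A.negS e w) := by
  refine LinearMap.ext fun x ↦ Subtype.ext ?_
  rw [Module.End.mul_apply, cliffordAction_apply, cliffordAction_apply,
    he.sharpMul_sharpMul_peirceHalf h2 w.2 x.2, Module.algebraMap_end_apply]
  rfl

include h2 he

theorem polar_negS (w v : A.peirceZeroPerp e) :
    QuadraticMap.polar (A.negS e) w v = A.T (w : J) (v : J) := by
  have h (u : A.peirceZeroPerp e) : 2 * A.negS e u = A.T (u : J) (u : J) := by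
    rw [he.T_self_peirceZeroPerp h2 u.2]
    change 2 * -A.S (u : J) = _
    ring
  refine mul_left_cancel₀ h2 ?_
  rw [QuadraticMap.polar, mul_sub, mul_sub, h, h, h]
  simp only [Submodule.coe_add, map_add, LinearMap.add_apply, A.T_comm (v : J) (w : J)]
  ring

theorem polar_negS_nondegenerate (hnd : A.IsNondegenerate) (w : A.peirceZeroPerp e)
    (h : ∀ v, QuadraticMap.polar (A.negS e) w v = 0) : w = 0 :=
  Subtype.ext (he.eq_zero_of_T_peirceZeroPerp h2 hnd w.2 fun v hv ↦
    (he.polar_negS h2 w ⟨v, hv⟩).symm.trans (h ⟨v, hv⟩))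

/-- In dimension nine, the Peirce subspaces `J₀ ∩ π₃^⊥` and `J_{1/2}` have dimensions three and
four. -/
theorem finrank_peirce [IsAlgClosed k] (hdim : Module.finrank k J = 9) (hnd : A.IsNondegenerate)
    (hs : A.IsSimple) :
    Module.finrank k (A.peirceZeroPerp e) = 3 ∧ Module.finrank k (A.peirceHalf e) = 4 := by
  have : FiniteDimensional k J := .of_finrank_pos (by omega)
  have hM := he.peirceHalf_ne_bot h2 hs (by omega)
  have hW := he.peirceZeroPerp_ne_bot h2 hnd hM
  have hW1 := he.finrank_peirceZeroPerp_ne_one h2 hnd hs (by omega)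
  have hadd := he.finrank_add_finrank h2
  have hq := he.polar_negS_nondegenerate h2 hnd
  have hf := he.cliffordAction_mul_self h2
  have : Nontrivial (A.peirceHalf e) := Submodule.nontrivial_iff_ne_bot.2 hM
  have hle := finrank_le_of_cliffordModule hf hq
  have hW0 : Module.finrank k (A.peirceZeroPerp e) ≠ 0 := fun h ↦ hW (Submodule.finrank_eq_zero.1 h)
  have hM0 : Module.finrank k (A.peirceHalf e) ≠ 0 := fun h ↦ hM (Submodule.finrank_eq_zero.1 h)
  have heven : Even (Module.finrank k (A.peirceHalf e)) := by
    obtain ⟨b, hb, hbb⟩ := QuadraticForm.exists_orthonormal_basis h2 hq rfl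
    exact even_finrank_of_cliffordModule hf h2 (hb ⟨0, by omega⟩) (hb ⟨1, by omega⟩)
      (hbb _ _ (by simp))
  rw [hdim] at hadd
  obtain ⟨r, hr⟩ := heven
  rw [hr] at hadd hle hM0 ⊢
  -- dim W = 7 - 2r is at least 2; r = 1 would embed a five-dimensional W in the four-dimensional
  -- End M.
  have hr2 : r ≤ 2 := by omega
  interval_cases r <;> omega

/-- The form is T restricted to J_{1/2}; self-adjointness is the symmetry of the trilinear form T(x
♯ y, z). -/
theorem exists_selfAdjoint_form (hnd : A.IsNondegenerate) (hM : A.peirceHalf e ≠ ⊥) :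
    ∃ B : LinearMap.BilinForm k (A.peirceHalf e), B ≠ 0 ∧
      ∀ w x y, B (he.cliffordAction h2 w x) y = B x (he.cliffordAction h2 w y) := by
  refine ⟨A.T.restrict (A.peirceHalf e), fun h ↦ ?_, fun w x y ↦ ?_⟩
  · obtain ⟨x, hx, hx0⟩ := (Submodule.ne_bot_iff _).1 hM
    exact hx0 (he.eq_zero_of_T_peirceHalf h2 hnd hx fun y hy ↦
      congrArg (fun B : LinearMap.BilinForm k (A.peirceHalf e) ↦ B ⟨x, hx⟩ ⟨y, hy⟩) h)
  · exact A.T_sharpMul_left (w : J) (x : J) (y : J)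

end IsRankOneIdempotent

end CubicJordanAlgebra

theorem mainTheorem3 {k J : Type*} [Field k] [IsAlgClosed k] (h2 : (2 : k) ≠ 0)
    [AddCommGroup J] [Module k J] (hdim : Module.finrank k J = 9)
    (A : CubicJordanAlgebra k J) (hnd : A.IsNondegenerate) (hs : A.IsSimple)
    (υ : J) (hυ : A.IsPrimitiveIdempotent υ) :
    (Module.finrank k (A.peirceZeroPerp υ) = 3 ∧
      ∃ f : A.peirceZeroPerp υ →ₗ[k] Module.End k (A.peirceHalf υ),
        (∀ (π : A.peirceZeroPerp υ) (ρ : A.peirceHalf υ),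
          ((f π ρ : A.peirceHalf υ) : J) = A.sharpMul (π : J) (ρ : J)) ∧
        ∃ e : CliffordAlgebra (A.negS υ) ≃ₐ[k]
            Algebra.adjoin k (Set.range (f : A.peirceZeroPerp υ → Module.End k (A.peirceHalf υ))),
          ∀ π : A.peirceZeroPerp υ,
            ((e (CliffordAlgebra.ι (A.negS υ) π) :
              Algebra.adjoin k
                (Set.range (f : A.peirceZeroPerp υ → Module.End k (A.peirceHalf υ)))) :
              Module.End k (A.peirceHalf υ)) = f π) ∧
    (∀ (π₁ π₂ π₄ : J), LinearIndependent k ![π₁, π₂, π₄] →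
      Submodule.span k {π₁, π₂, π₄} = A.peirceZeroPerp υ →
      ∃ V : Submodule k J, V ≤ A.peirceHalf υ ∧ Module.finrank k V = 2 ∧
        V.map (A.sharpMul π₂) ≤ V ∧ V.map (A.sharpMul π₄) ≤ V ∧
        Module.finrank k (V.map (A.sharpMul π₁)) = 2 ∧
        Disjoint V (V.map (A.sharpMul π₁)) ∧
        V ⊔ V.map (A.sharpMul π₁) = A.peirceHalf υ) := by
  have he := hυ.isRankOneIdempotent h2
  obtain ⟨hW, hM⟩ := he.finrank_peirce h2 hdim hnd hs
  have hM0 : A.peirceHalf υ ≠ ⊥ := he.peirceHalf_ne_bot h2 hs (by omega)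
  obtain ⟨B, hB, hBf⟩ := he.exists_selfAdjoint_form h2 hnd hM0
  have hf := he.cliffordAction_mul_self h2
  have hq := he.polar_negS_nondegenerate h2 hnd
  refine ⟨⟨hW, he.cliffordAction h2, he.cliffordAction_apply h2,
    exists_cliffordAlgebra_equiv_adjoin hf hq h2 hW hB hBf⟩, fun π₁ π₂ π₄ _ hspan ↦ ?_⟩
  have hmem (π : J) (hπ : π ∈ ({π₁, π₂, π₄} : Set J)) : π ∈ A.peirceZeroPerp υ :=
    hspan ▸ Submodule.subset_span hπ
  have h₁ := hmem π₁ (by simp)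
  have h₂ := hmem π₂ (by simp)
  have h₄ := hmem π₄ (by simp)
  have hspan' : Submodule.span k {(⟨π₁, h₁⟩ : A.peirceZeroPerp υ), ⟨π₂, h₂⟩, ⟨π₄, h₄⟩} = ⊤ := by
    apply Submodule.map_injective_of_injective (A.peirceZeroPerp υ).injective_subtype
    rw [Submodule.map_span, Submodule.map_subtype_top]
    simpa [Set.image_insert_eq] using hspan
  obtain ⟨V, hV, hV₂, hV₄, hV₁, hdis, hsup⟩ :=
    exists_cliffordModule_splitting hf hq h2 hW hM hB hBf hspan'
  have hmap (π : J) (hπ : π ∈ A.peirceZeroPerp υ) :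
      (V.map (A.peirceHalf υ).subtype).map (A.sharpMul π) =
        (V.map (he.cliffordAction h2 ⟨π, hπ⟩)).map (A.peirceHalf υ).subtype := by
    rw [← Submodule.map_comp, ← Submodule.map_comp]
    rfl
  have hinj := (A.peirceHalf υ).injective_subtype
  refine ⟨V.map (A.peirceHalf υ).subtype, Submodule.map_subtype_le _ _, ?_, ?_, ?_, ?_, ?_, ?_⟩
  · rw [← hV]
    exact (Submodule.equivMapOfInjective _ hinj V).finrank_eq.symm
  · rw [hmap π₂ h₂]
    exact Submodule.map_mono hV₂
  · rw [hmap π₄ h₄]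
    exact Submodule.map_mono hV₄
  · rw [hmap π₁ h₁, ← hV₁]
    exact (Submodule.equivMapOfInjective _ hinj _).finrank_eq.symm
  · rw [hmap π₁ h₁, disjoint_iff, ← Submodule.map_inf _ hinj, disjoint_iff.1 hdis,
      Submodule.map_bot]
  · rw [hmap π₁ h₁, ← Submodule.map_sup, hsup, Submodule.map_subtype_top]
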